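/- Let $\mathbb{Z}=\mathbb{S}^p\times\cdots\times\mathbb{S}^p$ ($K$ copies of the space of real symmetric $p\times p$ matrices) with inner product $\langle X,Y\rangle=\sum_k \mathrm{tr}(X^{(k)}Y^{(k)})$ and Euclidean norms on $\mathbb{Z}$ and $\mathbb{Z}^3$. Let $w^{(k)}\in\mathbb{R}^{n_k\times p}$ ($n_k\ge 1$, $k=1,\dots,K$) be data matrices, $S^{(k)}=\frac1{n_k}(w^{(k)})^Tw^{(k)}$, and $$f(\Theta)=\sum_{k=1}^K\big(h(\Theta^{(k)})+\langle S^{(k)},\Theta^{(k)}\rangle\big),\qquad h(A)=-\log\det A \text{ if } A\succ 0,\quad h(A)=+\infty \text{ otherwise.}$$ Let $\mathcal{P}:\mathbb{Z}\to\mathbb{R}\cup\{+\infty\}$ be the group graphical Lasso (GGL) regularizer $$\mathcal{P}(\Theta)=\lambda_1\sum_k\sum_{i\ne j}|\Theta^{(k)}_{ij}|+\lambda_2\sum_{i\neq j}\Big(\sum_k|\Theta^{(k)}_{ij}|^2\Big)^{1/2},\qquad \lambda_1,\lambda_2>0,$$ or, more generally, any proper, closed, convex, positively homogeneous function ($\mathcal{P}(t\Theta)=t\mathcal{P}(\Theta)$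 for $t>0$). Assume that $\min_{\Theta}\{f(\Theta)+\mathcal{P}(\Theta)\}$ has a solution with finite value. Write $g^*$ for the convex conjugate of $g$ and $\mathrm{Prox}_g(u)=\arg\min_{v}\{g(v)+\frac12\|v-u\|^2\}$. Define $\mathcal{H}:\mathbb{Z}^3\times\mathbb{Z}^3\to\mathbb{Z}^3$ by $$\mathcal{H}((U,V,W),(\Omega,\Theta,X))=\big(X-U+\mathrm{Prox}_{f^*}(\Omega-X+U),\ -X-V+\mathrm{Prox}_{\mathcal{P}^*}(\Theta+X+V),\ \Omega-\Theta+W\big).$$ Let $\mathcal{L}(\Omega,\Theta,X)=f(\Omega)+\mathcal{P}(\Theta)+\langle\Omega-\Theta,X\rangle$, and let $$\mathcal{S}(U,V,W)=\{(\Omega,\Theta,X)\in\mathbb{Z}^3 \mid (U,V,-W)\in\partial\mathcal{L}(\Omega,\Theta,X)\},$$ where $\partial\mathcal{L}$ is the convex-concave subdifferential (subgradients in $(\Omega,\Theta)$, supergradients in $X$); that is, $\mathcal{S}(U,V,W)$ is the set of KKT points of the linearly perturbed problem $$\min_{\Omega,\Theta}\ f(\Omega)+\mathcal{P}(\Theta)-\langle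 U,\Omega\rangle-\langle V,\Theta\rangle\quad\text{s.t.}\quad \Omega-\Theta+W=0.$$ The Clarke generalized Jacobian $\partial F(x)$ of a locally Lipschitz map $F$ is the convex hull of all limits of $F'(x_m)$ along sequences $x_m\to x$ of points of differentiability of $F$. Then the KKT system $\mathcal{H}((0,0,0),(\Omega,\Theta,X))=0$ has a unique solution $(\overline\Omega,\overline\Theta,\overline X)$, and: (a) Every $\mathcal{G}\in\partial_{(\Omega,\Theta,X)}\mathcal{H}((0,0,0),(\overline\Omega,\overline\Theta,\overline X))$ is nonsingular, where $\mathcal{G}$ belongs to this set if $(\mathcal{M},\mathcal{G})\in\partial\mathcal{H}((0,0,0),(\overline\Omega,\overline\Theta,\overline X))$ for some linear operator $\mathcal{M}$. (b) There are a neighborhood $\mathcal{N}$ of the origin in $\mathbb{Z}^3$ and $\kappa>0$ such that $\mathcal{S}(U,V,W)\ne\emptyset$ for all $(U,V,W)\in\mathcal{N}$ and, for all $(U,V,W),(U',V',W')\in\mathcal{N}$, all $z\in\mathcal{S}(U,V,W)$ and all $z'\in\mathcal{S}(U',V',W')$, $$\|z-z'\|\le\kappa\,\|(U,V,W)-(U',V',W')\|.$$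 In particular, $\mathcal{S}$ is single-valued on $\mathcal{N}$. -/

import Mathlib

noncomputable section

open Filter Topology

namespace GGL

/-! ### The space of tuples of symmetric matrices -/

/-- The subspace of those arrays `x (k, i, j)` all of whose slices `x (k, ·, ·)` are symmetric. -/
def symTuples (p K : ℕ) : Submodule ℝ (EuclideanSpace ℝ (Fin K × Fin p × Fin p)) where
  carrier := {x | ∀ k i j, x (k, i, j) = x (k, j, i)}
  zero_mem' := by intro k i j; simp
  add_mem' := by
    intro x y hx hy k i j
    simp [hx k i j, hy k i j]
  smul_mem' := by
    intro c x hx k i j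
    simp [hx k i j]

/-- The Cartesian product of `K` copies of the space of real symmetric `p × p` matrices, with the
inner product `⟪X, Y⟫ = ∑ k, trace (X⁽ᵏ⁾ Y⁽ᵏ⁾)` and its (Frobenius) norm. -/
abbrev SymTuple (p K : ℕ) : Type := ↥(symTuples p K)

/-- The `k`-th matrix `X⁽ᵏ⁾` of a tuple `X`. -/
def SymTuple.mat {p K : ℕ} (X : SymTuple p K) (k : Fin K) : Matrix (Fin p) (Fin p) ℝ :=
  Matrix.of fun i j => X.1 (k, i, j)

/-- Triples `(Ω, Θ, X)`, or `(U, V, W)`, of tuples of symmetric matrices. -/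
abbrev Triple (p K : ℕ) : Type := SymTuple p K × SymTuple p K × SymTuple p K

/-- The Euclidean norm of a triple (Mathlib's norm on a product is the maximum norm). -/
def tripleNorm {p K : ℕ} (z : Triple p K) : ℝ :=
  Real.sqrt (‖z.1‖ ^ 2 + ‖z.2.1‖ ^ 2 + ‖z.2.2‖ ^ 2)

/-! ### Convex analysis of extended real valued functions -/

section Convex

variable {E : Type*} [NormedAddCommGroup E] [InnerProductSpace ℝ E]

/-- The convex conjugate `g*(y) = sup_x (⟪y, x⟫ - g x)`. -/
def conjugate (g : E → EReal) (y : E) : EReal :=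
  ⨆ x : E, ((inner ℝ y x : ℝ) : EReal) - g x

/-- `v` minimizes `v' ↦ g v' + ‖v' - u‖² / 2`. -/
def IsProx (g : E → EReal) (u v : E) : Prop :=
  ∀ v' : E, g v + ((‖v - u‖ ^ 2 / 2 : ℝ) : EReal) ≤ g v' + ((‖v' - u‖ ^ 2 / 2 : ℝ) : EReal)

/-- The proximal mapping: the minimizer of `v ↦ g v + ‖v - u‖² / 2`, which exists and is unique
when `g` is proper, closed and convex. -/
def prox (g : E → EReal) (u : E) : E :=
  Classical.epsilon fun v => IsProx g u v

/-- `g` is a proper, closed (lower semicontinuous), convex and positively homogeneous function with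
values in `ℝ ∪ {+∞}`. -/
structure IsClosedConvexPosHom (g : E → EReal) : Prop where
  ne_bot : ∀ x, g x ≠ ⊥
  exists_ne_top : ∃ x, g x ≠ ⊤
  closed : LowerSemicontinuous g
  convex : Convex ℝ {q : E × ℝ | g q.1 ≤ ((q.2 : ℝ) : EReal)}
  posHom : ∀ (t : ℝ) (x : E), 0 < t → g (t • x) = (t : EReal) * g x

end Convex

/-! ### Clarke's generalized Jacobian -/

section Clarke

variable {E F G : Type*} [NormedAddCommGroup E] [NormedSpace ℝ E]
  [NormedAddCommGroup F] [NormedSpace ℝ F] [NormedAddCommGroup G] [NormedSpace ℝ G]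

/-- The generalized Jacobian of a locally Lipschitz map `Φ` at `x`: the convex hull of all limits of
the Jacobians of `Φ` along sequences of points of differentiability that converge to `x`. -/
def clarkeJacobian (Φ : E → F) (x : E) : Set (E →L[ℝ] F) :=
  convexHull ℝ {A | ∃ u : ℕ → E, Tendsto u atTop (𝓝 x) ∧ (∀ m, DifferentiableAt ℝ Φ (u m)) ∧
    Tendsto (fun m => fderiv ℝ Φ (u m)) atTop (𝓝 A)}

/-- The partial generalized Jacobian with respect to the second variable: all `B` such that
`(M, B) : (x, y) ↦ M x + B y` is in the generalized Jacobian of `Φ` at `(x, y)` for some `M`. -/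
def partialClarkeJacobian (Φ : E × F → G) (x : E) (y : F) : Set (F →L[ℝ] G) :=
  {B | ∃ M : E →L[ℝ] G, M.coprod B ∈ clarkeJacobian Φ (x, y)}

end Clarke

/-! ### The joint graphical model -/

section Model

variable {p K : ℕ}

/-- The empirical covariance matrices `S⁽ᵏ⁾ = (1 / n_k) (w⁽ᵏ⁾)ᵀ w⁽ᵏ⁾` of the data matrices. -/
def empCov (n : Fin K → ℕ) (w : (k : Fin K) → Matrix (Fin (n k)) (Fin p) ℝ) : SymTuple p K :=
  ⟨WithLp.toLp 2 fun q => (1 / (n q.1 : ℝ)) * ((w q.1).transpose * w q.1) q.2.1 q.2.2, by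
    intro k i j
    simp [Matrix.mul_apply, mul_comm]⟩

/-- The group graphical Lasso regularizer
`lam₁ ∑ₖ ∑_{i ≠ j} |Θ⁽ᵏ⁾ᵢⱼ| + lam₂ ∑_{i ≠ j} (∑ₖ |Θ⁽ᵏ⁾ᵢⱼ|²)^(1/2)`. -/
def gglReg (lam₁ lam₂ : ℝ) (Θ : SymTuple p K) : EReal :=
  ((lam₁ * ∑ k, ∑ q ∈ (Finset.univ : Finset (Fin p)).offDiag, |Θ.mat k q.1 q.2| +
    lam₂ * ∑ q ∈ (Finset.univ : Finset (Fin p)).offDiag,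
      Real.sqrt (∑ k, |Θ.mat k q.1 q.2| ^ 2) : ℝ) : EReal)

open Classical in
/-- The log-determinant function: `-log det A` if `A` is positive definite, and `+∞` otherwise. -/
def negLogDet (A : Matrix (Fin p) (Fin p) ℝ) : EReal :=
  if A.PosDef then ((-Real.log A.det : ℝ) : EReal) else ⊤

/-- `f(Θ) = ∑ₖ (-log det Θ⁽ᵏ⁾ + ⟪S⁽ᵏ⁾, Θ⁽ᵏ⁾⟫)`. -/
def loss (S : SymTuple p K) (Θ : SymTuple p K) : EReal :=
  ∑ k, (negLogDet (Θ.mat k) + ((((S.mat k).transpose * Θ.mat k).trace : ℝ) : EReal))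

/-- The solution set of `min_Θ f(Θ) + P(Θ)` (a solution has a finite objective value). -/
def solutionSet (S : SymTuple p K) (P : SymTuple p K → EReal) : Set (SymTuple p K) :=
  {Θ | loss S Θ + P Θ < ⊤ ∧ ∀ Θ', loss S Θ + P Θ ≤ loss S Θ' + P Θ'}

/-- The Lagrangian `L(Ω, Θ, X) = f(Ω) + P(Θ) + ⟪Ω - Θ, X⟫` of
`min {f(Ω) + P(Θ) | Ω - Θ = 0}`. -/
def lagrangian (S : SymTuple p K) (P : SymTuple p K → EReal) (Ω Θ X : SymTuple p K) : EReal :=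
  loss S Ω + P Θ + ((inner ℝ (Ω - Θ) X : ℝ) : EReal)

/-- `(A, B, C) ∈ ∂L(Ω, Θ, X)`, the subdifferential of the convex-concave function `L`: the pair
`(A, B)` is a subgradient of the convex function `L(·, ·, X)` at `(Ω, Θ)`, and `C` is a
supergradient of the concave function `L(Ω, Θ, ·)` at `X`. -/
def lagrangianSubdiff (S : SymTuple p K) (P : SymTuple p K → EReal) (z : Triple p K) :
    Set (Triple p K) :=
  {a | (∀ Ω' Θ' : SymTuple p K,
        lagrangian S P z.1 z.2.1 z.2.2 +
          ((inner ℝ a.1 (Ω' - z.1) + inner ℝ a.2.1 (Θ' - z.2.1) : ℝ) : EReal) ≤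
            lagrangian S P Ω' Θ' z.2.2) ∧
      (∀ X' : SymTuple p K,
        lagrangian S P z.1 z.2.1 X' ≤
          lagrangian S P z.1 z.2.1 z.2.2 + ((inner ℝ a.2.2 (X' - z.2.2) : ℝ) : EReal))}

/-- The operator `T_L(Ω, Θ, X) = {(U, V, W) | (U, V, -W) ∈ ∂L(Ω, Θ, X)}`. -/
def opT (S : SymTuple p K) (P : SymTuple p K → EReal) (z : Triple p K) : Set (Triple p K) :=
  {u | (u.1, u.2.1, -u.2.2) ∈ lagrangianSubdiff S P z}

/-- The KKT solution mapping `T_L⁻¹`: it maps `(U, V, W)` to the set of all KKT points of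
`min {f(Ω) + P(Θ) - ⟪U, Ω⟫ - ⟪V, Θ⟫ | Ω - Θ + W = 0}`. -/
def kktSol (S : SymTuple p K) (P : SymTuple p K → EReal) (u : Triple p K) : Set (Triple p K) :=
  {z | u ∈ opT S P z}

/-- The residual map `H((U, V, W), (Ω, Θ, X))` of the perturbed KKT system. -/
def kktResidual (S : SymTuple p K) (P : SymTuple p K → EReal) :
    Triple p K × Triple p K → Triple p K :=
  fun ((U, V, W), (Ω, Θ, X)) =>
    (X - U + prox (conjugate (loss S)) (Ω - X + U),
      -X - V + prox (conjugate P) (Θ + X + V),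
      Ω - Θ + W)

/-- The KKT system
`X + Prox_{f*}(Ω - X) = 0`, `-X + Prox_{P*}(Θ + X) = 0`, `Ω - Θ = 0`. -/
def IsKKT (S : SymTuple p K) (P : SymTuple p K → EReal) (z : Triple p K) : Prop :=
  z.2.2 + prox (conjugate (loss S)) (z.1 - z.2.2) = 0 ∧
    -z.2.2 + prox (conjugate P) (z.2.1 + z.2.2) = 0 ∧
    z.1 - z.2.1 = 0

end Model

end GGL

end

open GGL

/-!
Write `f` for the loss, `G = S - (·)⁻¹` for its gradient, and note that the regularizer `P` is in
either case a closed convex positively homogeneous function.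

The argument only uses monotonicity. The subdifferential of `P` is monotone. The gradient `G` of `f`
is, near every point of the open set of positive definite tuples, Lipschitz and *strongly* monotone:
with `Δ = A - B` one has `⟪B⁻¹ - A⁻¹, A - B⟫ = tr (B⁻¹ Δ A⁻¹ Δ) ≥ ‖Δ‖² / (tr A tr B)`
(`norm_sub_sq_le_trace`). Since `f` is differentiable wherever it is finite, a minimizer `x` of
`f + P` satisfies `-G x ∈ ∂P(x)`, and `(x, x, -G x)` is a KKT point. All triples at which the
perturbed saddle point condition holds are those with `U - X = G Ω`, `V + X ∈ ∂P(Θ)` and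
`Θ = Ω + W` (`mem_kktSol_iff`).

*Stability.* For two perturbed KKT points, monotonicity of `∂P` bounds `⟪G Ω - G Ω', Θ - Θ'⟫` by the
difference of the data times `‖Θ - Θ'‖`. As `Θ - Θ' = Ω - (Ω' - (W - W'))`, strong monotonicity of
`G` bounds it from below (`IsLocallyStronglyConvex.min_norm_le`). The estimate is valid even if `Ω`
is far away, so that it first shows that all KKT points for small data are near the unperturbed one,
and then that they depend on the data in a Lipschitz way. Existence for small data follows by
minimizing the perturbed objective over a small ball, where strong monotonicity keeps the minimizer
off the boundary (`IsLocallyStronglyConvex.exists_isPerturbedKKT`).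

*Nonsingularity.* If `y ∈ ∂g(x)` then `Prox_{g*}(x + y) = y`, so `Prox_{P*}` is firmly nonexpansive,
and near `x + G x` the map `Prox_{f*}` is so with an additional term `c ‖u - u'‖²`, for some `c > 0`.
These quadratic inequalities between increments of the residual map define a closed cone with convex
fibres; hence they are inherited by derivatives, their limits and convex combinations, that is, by
all elements of Clarke's Jacobian (`clarkeJacobian_graph_subset`). They force the kernel of the
partial Jacobian to be zero (`bijective_of_mem_residualCone`). No second order differentiation of the
log-determinant is needed.
-/

open GGL

namespace GGL

open Filter Topology

/-! ### Subgradients and proximal mappings of conjugate functions -/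

section Subgradient

variable {E : Type*} [NormedAddCommGroup E] [InnerProductSpace ℝ E]

/-- `y` is a subgradient of the extended real valued function `g` at the point `x`, at which `g`
is required to be finite. -/
def IsSubgradient (g : E → EReal) (x y : E) : Prop :=
  g x ≠ ⊤ ∧ g x ≠ ⊥ ∧ ∀ x', g x + ((inner ℝ y (x' - x) : ℝ) : EReal) ≤ g x'

lemma IsSubgradient.exists_real {g : E → EReal} {x y : E} (h : IsSubgradient g x y) :
    ∃ r : ℝ, g x = r ∧ ∀ x', ((r + inner ℝ y (x' - x) : ℝ) : EReal) ≤ g x' := by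
  obtain ⟨h1, h2, h3⟩ := h
  lift g x to ℝ using ⟨h1, h2⟩ with r
  exact ⟨r, rfl, fun x' => by simpa using h3 x'⟩

lemma isSubgradient_of_real {g : E → EReal} {x y : E} {r : ℝ} (hr : g x = r)
    (h : ∀ x', ((r + inner ℝ y (x' - x) : ℝ) : EReal) ≤ g x') : IsSubgradient g x y :=
  ⟨by simp [hr], by simp [hr], fun x' => by simpa [hr] using h x'⟩

/-- The subdifferential is a monotone operator. -/
lemma IsSubgradient.monotone {g : E → EReal} {x y x' y' : E} (h : IsSubgradient g x y)
    (h' : IsSubgradient g x' y') : 0 ≤ inner ℝ (y - y') (x - x') := by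
  obtain ⟨r, hr, h⟩ := h.exists_real
  obtain ⟨r', hr', h'⟩ := h'.exists_real
  have h1 := h x'
  have h2 := h' x
  rw [hr', EReal.coe_le_coe_iff] at h1
  rw [hr, EReal.coe_le_coe_iff] at h2
  have h3 : inner ℝ y (x' - x) = - inner ℝ y (x - x') := by rw [← inner_neg_right, neg_sub]
  rw [inner_sub_left]
  linarith

/-- Moreau's identity in the form used here: if `y ∈ ∂g(x)`, then `y` is the only minimizer in the
definition of `Prox_{g*}(x + y)`. By the Fenchel equality the conjugate satisfies
`g*(v) ≥ g*(y) + ⟪v - y, x⟫`, and completing the square gives the claim. -/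
lemma IsSubgradient.isProx_conjugate_iff {g : E → EReal} {x y : E} (h : IsSubgradient g x y)
    (v : E) : IsProx (conjugate g) (x + y) v ↔ v = y := by
  obtain ⟨r, hr, h⟩ := h.exists_real
  have hy : conjugate g y = ((inner ℝ y x - r : ℝ) : EReal) := by
    apply le_antisymm
    · refine iSup_le fun x' => ?_
      have := h x'
      rw [inner_sub_right] at this
      induction hx' : g x' with
      | bot => rw [hx'] at this; simp only [le_bot_iff, EReal.coe_ne_bot] at this
      | top => simp
      | coe s =>
        rw [hx', EReal.coe_le_coe_iff] at this
        rw [← EReal.coe_sub, EReal.coe_le_coe_iff]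
        linarith
    · refine le_trans ?_ (le_iSup (fun x' => ((inner ℝ y x' : ℝ) : EReal) - g x') x)
      rw [hr, EReal.coe_sub]
  have hv : ∀ v, ((inner ℝ v x - r : ℝ) : EReal) ≤ conjugate g v := fun v => by
    refine le_trans ?_ (le_iSup (fun x' => ((inner ℝ v x' : ℝ) : EReal) - g x') x)
    rw [hr, EReal.coe_sub]
  have hsq : ∀ v : E, inner ℝ v x - r + ‖v - (x + y)‖ ^ 2 / 2
      = inner ℝ y x - r + ‖y - (x + y)‖ ^ 2 / 2 + ‖v - y‖ ^ 2 / 2 := fun v => by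
    have e1 : v - (x + y) = (v - y) - x := by abel
    have e2 : y - (x + y) = -x := by abel
    rw [e1, e2, norm_sub_sq_real, norm_neg, inner_sub_left]
    ring
  constructor
  · intro hp
    have h1 := hp y
    rw [hy] at h1
    have h2 : ((inner ℝ v x - r + ‖v - (x + y)‖ ^ 2 / 2 : ℝ) : EReal) ≤
        ((inner ℝ y x - r + ‖y - (x + y)‖ ^ 2 / 2 : ℝ) : EReal) := by
      rw [EReal.coe_add, EReal.coe_add]
      exact (add_le_add_left (hv v) _).trans h1
    rw [EReal.coe_le_coe_iff, hsq v] at h2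
    have h3 : ‖v - y‖ ^ 2 = 0 := le_antisymm (by linarith) (sq_nonneg _)
    exact sub_eq_zero.1 (norm_eq_zero.1 (pow_eq_zero_iff two_ne_zero |>.1 h3))
  · rintro rfl v'
    rw [hy]
    refine le_trans ?_ (add_le_add_left (hv v') _)
    rw [← EReal.coe_add, ← EReal.coe_add, EReal.coe_le_coe_iff, hsq v']
    linarith [sq_nonneg ‖v' - v‖]

lemma IsSubgradient.prox_conjugate {g : E → EReal} {x y : E} (h : IsSubgradient g x y) :
    prox (conjugate g) (x + y) = y :=
  (h.isProx_conjugate_iff _).1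
    (Classical.epsilon_spec (p := fun v => IsProx (conjugate g) (x + y) v)
      ⟨y, (h.isProx_conjugate_iff y).2 rfl⟩)

/-- Every point is of the form `x + y` with `y ∈ ∂g(x)`: the operator `I + ∂g` is onto. This is what
makes `Prox_{g*}` a genuine (everywhere defined) map. -/
def ResolventOnto (g : E → EReal) : Prop :=
  ∀ u : E, ∃ x y, x + y = u ∧ IsSubgradient g x y

lemma ResolventOnto.prox_conjugate_eq_iff {g : E → EReal} (hg : ResolventOnto g) {x y : E} :
    prox (conjugate g) (x + y) = y ↔ IsSubgradient g x y := by
  refine ⟨fun h => ?_, fun h => h.prox_conjugate⟩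
  obtain ⟨x', y', hu, h'⟩ := hg (x + y)
  rw [← hu, h'.prox_conjugate] at h
  subst h
  rwa [add_right_cancel hu] at h'

/-- The proximal mapping of a conjugate function is firmly nonexpansive. -/
lemma ResolventOnto.firmlyNonexpansive {g : E → EReal} (hg : ResolventOnto g) (u u' : E) :
    ‖prox (conjugate g) u - prox (conjugate g) u'‖ ^ 2 ≤
      inner ℝ (prox (conjugate g) u - prox (conjugate g) u') (u - u') := by
  obtain ⟨x, y, rfl, h⟩ := hg u
  obtain ⟨x', y', rfl, h'⟩ := hg u'
  rw [h.prox_conjugate, h'.prox_conjugate]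
  have e : x + y - (x' + y') = (x - x') + (y - y') := by abel
  rw [e, inner_add_right, real_inner_self_eq_norm_sq]
  linarith [h.monotone h']

/-- First order optimality: if `x` minimizes `φ + g` near `x` on the segment towards `x'`, where `g`
is convex and `φ` is convex with continuous gradient `G`, then the subgradient inequality for
`-G x` holds at `x'`. -/
lemma subgradient_inequality_of_min {g : E → EReal} (hbot : ∀ x, g x ≠ ⊥)
    (hconv : Convex ℝ {q : E × ℝ | g q.1 ≤ ((q.2 : ℝ) : EReal)}) {φ : E → ℝ} {G : E → E}
    {x x' : E} (hx : g x ≠ ⊤) (hG : ContinuousAt G x)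
    (hφ : ∀ᶠ y in 𝓝 x, φ y + inner ℝ (G y) (x - y) ≤ φ x)
    (hmin : ∀ᶠ t in 𝓝[>] (0 : ℝ), (φ x : EReal) + g x ≤
      (φ (x + t • (x' - x)) : EReal) + g (x + t • (x' - x))) :
    g x + ((inner ℝ (-G x) (x' - x) : ℝ) : EReal) ≤ g x' := by
  obtain ⟨a, ha⟩ : ∃ a : ℝ, g x = a := by
    lift g x to ℝ using ⟨hx, hbot x⟩ with a
    exact ⟨a, rfl⟩
  induction hb : g x' with
  | bot => exact absurd hb (hbot x')
  | top => exact le_top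
  | coe b =>
    have hcont : ContinuousAt (fun t : ℝ => x + t • (x' - x)) 0 := by fun_prop
    have hcont0 : Tendsto (fun t : ℝ => x + t • (x' - x)) (𝓝[>] 0) (𝓝 x) := by
      have : Tendsto (fun t : ℝ => x + t • (x' - x)) (𝓝 0) (𝓝 x) := by
        simpa [ContinuousAt] using hcont
      exact this.mono_left nhdsWithin_le_nhds
    have hlim : Tendsto (fun t : ℝ => inner ℝ (G (x + t • (x' - x))) (x' - x)) (𝓝[>] 0)
        (𝓝 (inner ℝ (G x) (x' - x))) := (hG.tendsto.comp hcont0).inner tendsto_const_nhds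
    have hle : a - b ≤ inner ℝ (G x) (x' - x) := by
      refine ge_of_tendsto hlim ?_
      filter_upwards [hmin, hcont0.eventually hφ, self_mem_nhdsWithin,
        Ioo_mem_nhdsGT (zero_lt_one (α := ℝ))] with t h1 h2 ht0 ht1
      have h3 : g (x + t • (x' - x)) ≤ ((a + t * (b - a) : ℝ) : EReal) := by
        have hpa : ((x, a) : E × ℝ) ∈ {q : E × ℝ | g q.1 ≤ ((q.2 : ℝ) : EReal)} := ha.le
        have hpb : ((x', b) : E × ℝ) ∈ {q : E × ℝ | g q.1 ≤ ((q.2 : ℝ) : EReal)} := hb.le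
        have := hconv.add_smul_sub_mem hpa hpb ⟨ht1.1.le, ht1.2.le⟩
        simpa using this
      rw [ha] at h1
      have h4 := h1.trans (add_le_add_right h3 _)
      rw [← EReal.coe_add, ← EReal.coe_add, EReal.coe_le_coe_iff] at h4
      have h5 : x - (x + t • (x' - x)) = -(t • (x' - x)) := by abel
      rw [h5, inner_neg_right, inner_smul_right] at h2
      have ht : 0 < t := ht0
      have h6 : t * (a - b) ≤ t * inner ℝ (G (x + t • (x' - x))) (x' - x) := by linarith
      exact le_of_mul_le_mul_left h6 ht
    rw [ha, ← EReal.coe_add, EReal.coe_le_coe_iff, inner_neg_left]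
    linarith

end Subgradient

/-! ### Closed convex positively homogeneous functions -/

section PosHom

variable {E : Type*} [NormedAddCommGroup E] [InnerProductSpace ℝ E]

lemma exists_min_on_closedBall [FiniteDimensional ℝ E] {g : E → EReal}
    (hclosed : LowerSemicontinuous g) {φ : E → ℝ} {a : E} {R : ℝ}
    (hR : 0 ≤ R) (hφ : ContinuousOn φ (Metric.closedBall a R)) :
    ∃ x ∈ Metric.closedBall a R, ∀ y ∈ Metric.closedBall a R,
      (φ x : EReal) + g x ≤ (φ y : EReal) + g y := by
  have := FiniteDimensional.proper ℝ E
  have h1 : LowerSemicontinuousOn (fun x => (φ x : EReal)) (Metric.closedBall a R) :=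
    (continuous_coe_real_ereal.comp_continuousOn hφ).lowerSemicontinuousOn
  have h2 := h1.add' (hclosed.lowerSemicontinuousOn (Metric.closedBall a R)) fun x _ =>
    EReal.continuousAt_add (Or.inl (EReal.coe_ne_top _)) (Or.inl (EReal.coe_ne_bot _))
  obtain ⟨x, hx, hmin⟩ := h2.exists_isMinOn ⟨a, Metric.mem_closedBall_self hR⟩
    (isCompact_closedBall a R)
  exact ⟨x, hx, fun y hy => hmin hy⟩

namespace IsClosedConvexPosHom

variable {g : E → EReal}

lemma apply_zero (hg : IsClosedConvexPosHom g) : g 0 = 0 := by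
  obtain ⟨x, hx⟩ := hg.exists_ne_top
  obtain ⟨a, ha⟩ : ∃ a : ℝ, g x = a := by
    have hb := hg.ne_bot x
    lift g x to ℝ using ⟨hx, hb⟩ with a
    exact ⟨a, rfl⟩
  -- Lower semicontinuity along `t • x` with `t → 0` bounds the value at the origin.
  have hle : g 0 ≤ 0 := by
    by_contra! hpos
    obtain ⟨c, hc0, hc⟩ := EReal.lt_iff_exists_real_btwn.1 hpos
    have hc0' : 0 < c := by exact_mod_cast hc0
    have hev := hg.closed 0 c hc
    have ht : Tendsto (fun t : ℝ => t • x) (𝓝[>] 0) (𝓝 0) := by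
      have : ContinuousAt (fun t : ℝ => t • x) 0 := by fun_prop
      have h2 : Tendsto (fun t : ℝ => t • x) (𝓝 0) (𝓝 0) := by simpa [ContinuousAt] using this
      exact h2.mono_left nhdsWithin_le_nhds
    have ht2 : Tendsto (fun t : ℝ => t * a) (𝓝[>] 0) (𝓝 0) := by
      have : ContinuousAt (fun t : ℝ => t * a) 0 := by fun_prop
      have h2 : Tendsto (fun t : ℝ => t * a) (𝓝 0) (𝓝 0) := by simpa [ContinuousAt] using this
      exact h2.mono_left nhdsWithin_le_nhds
    obtain ⟨t, h1, h2, h3⟩ := ((ht.eventually hev).and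
      ((ht2.eventually (gt_mem_nhds hc0')).and self_mem_nhdsWithin)).exists
    rw [hg.posHom t x h3, ha, ← EReal.coe_mul, gt_iff_lt, EReal.coe_lt_coe_iff] at h1
    exact absurd h1 (not_lt.2 h2.le)
  have h2 := hg.posHom 2 0 two_pos
  rw [smul_zero] at h2
  have hb := hg.ne_bot 0
  have ht : g 0 ≠ ⊤ := fun h => by simp [h] at hle
  lift g 0 to ℝ using ⟨ht, hb⟩ with r
  rw [← EReal.coe_mul, EReal.coe_eq_coe_iff] at h2
  have : r = 0 := by linarith
  simp [this]

lemma exists_lower_bound [FiniteDimensional ℝ E] (hg : IsClosedConvexPosHom g) :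
    ∃ m : ℝ, 0 ≤ m ∧ ∀ x, ((-(m * ‖x‖) : ℝ) : EReal) ≤ g x := by
  obtain ⟨x₀, -, hmin⟩ := exists_min_on_closedBall (φ := fun _ => 0) (a := (0 : E)) (R := 1)
    hg.closed zero_le_one continuousOn_const
  simp only [EReal.coe_zero, zero_add] at hmin
  have h0 := hmin 0 (by simp)
  rw [hg.apply_zero] at h0
  have hb := hg.ne_bot x₀
  have ht : g x₀ ≠ ⊤ := fun h => by simp [h] at h0
  lift g x₀ to ℝ using ⟨ht, hb⟩ with r
  have hr : r ≤ 0 := by exact_mod_cast h0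
  refine ⟨-r, by linarith, fun x => ?_⟩
  rcases eq_or_ne x 0 with rfl | hx
  · simp [hg.apply_zero]
  · have hn : 0 < ‖x‖ := norm_pos_iff.2 hx
    have h1 := hmin (‖x‖⁻¹ • x) (by simp [norm_smul, hn.ne'])
    have h2 := hg.posHom ‖x‖ (‖x‖⁻¹ • x) hn
    rw [smul_inv_smul₀ hn.ne'] at h2
    rw [h2]
    have h3 : ((‖x‖ : ℝ) : EReal) * (r : EReal) ≤ ((‖x‖ : ℝ) : EReal) * g (‖x‖⁻¹ • x) :=
      mul_le_mul_of_nonneg_left h1 (by exact_mod_cast hn.le)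
    refine le_trans (le_of_eq ?_) h3
    rw [← EReal.coe_mul]
    congr 1
    ring

/-- The linear lower bound makes `g + ‖· - u‖² / 2` coercive, so it has a minimizer `x`, and
`u - x ∈ ∂g(x)`. -/
lemma resolventOnto [FiniteDimensional ℝ E] (hg : IsClosedConvexPosHom g) :
    ResolventOnto g := by
  intro u
  obtain ⟨m, hm, hlow⟩ := hg.exists_lower_bound
  set R : ℝ := 2 * (‖u‖ + m) + 1 with hRdef
  have hR : 0 < R := by positivity
  obtain ⟨x, hxR, hmin⟩ := exists_min_on_closedBall (φ := fun y => ‖y - u‖ ^ 2 / 2) (a := (0 : E))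
    hg.closed hR.le (by fun_prop)
  have h0 := hmin 0 (by simp [hR.le])
  rw [hg.apply_zero, add_zero, zero_sub, norm_neg] at h0
  have hxt : g x ≠ ⊤ := fun h => by
    rw [h, EReal.coe_add_top] at h0
    exact absurd h0 (by simp)
  have hxlt : ‖x‖ < R := by
    have h1 := (add_le_add_right (hlow x) _).trans h0
    rw [← EReal.coe_add, EReal.coe_le_coe_iff, norm_sub_sq_real] at h1
    have h2 := real_inner_le_norm x u
    have h3 : ‖x‖ * ‖x‖ ≤ ‖x‖ * (2 * (‖u‖ + m)) := by nlinarith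
    by_contra! hc
    have h4 : 0 < ‖x‖ := hR.trans_le hc
    have := le_of_mul_le_mul_left h3 h4
    linarith
  refine ⟨x, u - x, by abel, hxt, hg.ne_bot x, fun x' => ?_⟩
  have key := subgradient_inequality_of_min (φ := fun y => ‖y - u‖ ^ 2 / 2)
    (G := fun y => y - u) (x' := x') hg.ne_bot hg.convex hxt (by fun_prop) ?_ ?_
  · rwa [neg_sub] at key
  · refine Eventually.of_forall fun y => ?_
    have e : x - u = (y - u) + (x - y) := by abel
    rw [e, norm_add_sq_real]
    linarith [sq_nonneg ‖x - y‖]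
  · have hcont : ContinuousAt (fun t : ℝ => x + t • (x' - x)) 0 := by fun_prop
    have hev : ∀ᶠ t in 𝓝 (0 : ℝ), x + t • (x' - x) ∈ Metric.ball (0 : E) R :=
      hcont.eventually (Metric.isOpen_ball.mem_nhds (by simpa using hxlt))
    filter_upwards [nhdsWithin_le_nhds hev] with t ht
    exact hmin _ (Metric.ball_subset_closedBall ht)

end IsClosedConvexPosHom

end PosHom

/-! ### Convex functions with a locally strongly monotone gradient -/

section LocallyStrong

variable {E : Type*} [NormedAddCommGroup E] [InnerProductSpace ℝ E]

/-- `c` is a modulus of strong monotonicity and `L` a Lipschitz constant of `G` on the open ball of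
radius `r > 0` around `x`. -/
structure IsStrongOnBall (G : E → E) (x : E) (r c L : ℝ) : Prop where
  radius_pos : 0 < r
  modulus_pos : 0 < c
  lipschitz_nonneg : 0 ≤ L
  strong : ∀ y ∈ Metric.ball x r, ∀ z ∈ Metric.ball x r,
    c * ‖y - z‖ ^ 2 ≤ inner ℝ (G y - G z) (y - z)
  lipschitz : ∀ y ∈ Metric.ball x r, ∀ z ∈ Metric.ball x r, ‖G y - G z‖ ≤ L * ‖y - z‖

/-- The extended real valued function `f` equals the real function `φ` on its open domain `D` and
`+∞` elsewhere; `φ` is convex on `D` with gradient `G` (in the sense of the gradient inequality),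
`G` is locally Lipschitz and locally strongly monotone, and `I + G` maps `D` onto the whole space. -/
structure IsLocallyStronglyConvex (f : E → EReal) (D : Set E) (φ : E → ℝ) (G : E → E) : Prop where
  isOpen : IsOpen D
  coe_eq : ∀ x ∈ D, f x = φ x
  eq_top : ∀ x, x ∉ D → f x = ⊤
  gradient : ∀ x ∈ D, ∀ y ∈ D, φ x + inner ℝ (G x) (y - x) ≤ φ y
  continuousOn : ContinuousOn φ D
  strong : ∀ x ∈ D, ∃ r c L : ℝ, Metric.ball x r ⊆ D ∧ IsStrongOnBall G x r c L
  onto : ∀ u, ∃ q ∈ D, q + G q = u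

namespace IsLocallyStronglyConvex

variable {f : E → EReal} {D : Set E} {φ : E → ℝ} {G : E → E}

lemma ne_bot (hf : IsLocallyStronglyConvex f D φ G) (x : E) : f x ≠ ⊥ := by
  by_cases hx : x ∈ D
  · simp [hf.coe_eq x hx]
  · simp [hf.eq_top x hx]

lemma mem_of_ne_top (hf : IsLocallyStronglyConvex f D φ G) {x : E} (h : f x ≠ ⊤) : x ∈ D := by
  by_contra hx
  exact h (hf.eq_top x hx)

lemma continuousAt (hf : IsLocallyStronglyConvex f D φ G) {x : E} (hx : x ∈ D) :
    ContinuousAt G x := by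
  obtain ⟨r, c, L, -, h⟩ := hf.strong x hx
  have h0 : Tendsto (fun y => L * ‖y - x‖) (𝓝 x) (𝓝 0) := by
    have : ContinuousAt (fun y => L * ‖y - x‖) x := by fun_prop
    simpa [ContinuousAt] using this
  rw [ContinuousAt, tendsto_iff_norm_sub_tendsto_zero]
  refine squeeze_zero' (Eventually.of_forall fun _ => norm_nonneg _) ?_ h0
  filter_upwards [Metric.ball_mem_nhds x h.radius_pos] with y hy
  exact h.lipschitz y hy x (Metric.mem_ball_self h.radius_pos)

lemma monotone (hf : IsLocallyStronglyConvex f D φ G) {x y : E} (hx : x ∈ D) (hy : y ∈ D) :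
    0 ≤ inner ℝ (G x - G y) (x - y) := by
  have h1 := hf.gradient x hx y hy
  have h2 := hf.gradient y hy x hx
  have h3 : inner ℝ (G x) (y - x) = - inner ℝ (G x) (x - y) := by rw [← inner_neg_right, neg_sub]
  rw [inner_sub_left]
  linarith

lemma isSubgradient (hf : IsLocallyStronglyConvex f D φ G) {x : E} (hx : x ∈ D) :
    IsSubgradient f x (G x) := by
  refine isSubgradient_of_real (hf.coe_eq x hx) fun x' => ?_
  by_cases hx' : x' ∈ D
  · rw [hf.coe_eq x' hx', EReal.coe_le_coe_iff]
    exact hf.gradient x hx x' hx'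
  · rw [hf.eq_top x' hx']
    exact le_top

/-- The only subgradient at a point of the domain is the gradient: apply monotonicity along the
segment `x + t d` with `d = y - G x` and let `t → 0`. -/
lemma isSubgradient_iff (hf : IsLocallyStronglyConvex f D φ G) {x y : E} :
    IsSubgradient f x y ↔ x ∈ D ∧ y = G x := by
  refine ⟨fun h => ?_, fun ⟨hx, hy⟩ => hy ▸ hf.isSubgradient hx⟩
  have hx := hf.mem_of_ne_top h.1
  refine ⟨hx, ?_⟩
  set d := y - G x with hd
  have hcont : ContinuousAt (fun t : ℝ => x + t • d) 0 := by fun_prop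
  have hcont0 : Tendsto (fun t : ℝ => x + t • d) (𝓝[>] 0) (𝓝 x) := by
    have : Tendsto (fun t : ℝ => x + t • d) (𝓝 0) (𝓝 x) := by simpa [ContinuousAt] using hcont
    exact this.mono_left nhdsWithin_le_nhds
  have hlim : Tendsto (fun t : ℝ => inner ℝ (y - G (x + t • d)) d) (𝓝[>] 0)
      (𝓝 (inner ℝ (y - G x) d)) :=
    (tendsto_const_nhds.sub ((hf.continuousAt hx).tendsto.comp hcont0)).inner tendsto_const_nhds
  have hle : inner ℝ (y - G x) d ≤ 0 := by
    refine le_of_tendsto hlim ?_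
    filter_upwards [hcont0.eventually (hf.isOpen.mem_nhds hx), self_mem_nhdsWithin] with t ht ht0
    have h1 := h.monotone (hf.isSubgradient ht)
    rw [show x - (x + t • d) = -(t • d) by abel, inner_neg_right, inner_smul_right] at h1
    have ht0' : 0 < t := ht0
    by_contra! hc
    have := mul_pos ht0' hc
    linarith
  rw [← hd, real_inner_self_eq_norm_sq] at hle
  have : ‖d‖ = 0 := by
    have := sq_nonneg ‖d‖
    exact (pow_eq_zero_iff two_ne_zero).1 (le_antisymm hle this)
  exact sub_eq_zero.1 (norm_eq_zero.1 this)

lemma resolventOnto (hf : IsLocallyStronglyConvex f D φ G) : ResolventOnto f := fun u => by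
  obtain ⟨q, hq, h⟩ := hf.onto u
  exact ⟨q, G q, h, hf.isSubgradient hq⟩

/-- Strong monotonicity on a ball propagates, with linear growth, to all points of the domain: go
from `y` towards `z`, leave the ball after a step of length `r / 2`, and use monotonicity on the
rest of the segment. -/
lemma strong_of_mem (hf : IsLocallyStronglyConvex f D φ G) {x : E} {r c L : ℝ}
    (hr : Metric.ball x r ⊆ D) (h : IsStrongOnBall G x r c L) {y z : E}
    (hy : y ∈ Metric.ball x (r / 3)) (hz : z ∈ D) :
    c * min ‖z - y‖ (r / 2) * ‖z - y‖ ≤ inner ℝ (G z - G y) (z - y) := by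
  have hr0 := h.radius_pos
  have hc0 := h.modulus_pos
  have hy' : ‖y - x‖ < r / 3 := mem_ball_iff_norm.1 hy
  have hyr : y ∈ Metric.ball x r := Metric.ball_subset_ball (by linarith) hy
  rcases lt_or_ge ‖z - y‖ (r / 2) with hlt | hge
  · rw [min_eq_left hlt.le]
    have hzr : z ∈ Metric.ball x r := by
      rw [mem_ball_iff_norm, ← sub_add_sub_cancel z y x]
      exact (norm_add_le _ _).trans_lt (by linarith)
    have := h.strong z hzr y hyr
    linarith [sq ‖z - y‖]
  · rw [min_eq_right hge]
    have hn : 0 < ‖z - y‖ := by linarith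
    set s : ℝ := r / 2 / ‖z - y‖ with hs
    have hs0 : 0 < s := by positivity
    have hs1 : s ≤ 1 := (div_le_one hn).2 hge
    have hsn : s * ‖z - y‖ = r / 2 := div_mul_cancel₀ _ hn.ne'
    set z' := y + s • (z - y) with hz'
    have hzy : z' - y = s • (z - y) := by rw [hz']; abel
    have hzz : z - z' = (1 - s) • (z - y) := by rw [hz', sub_smul, one_smul]; abel
    have hz'r : z' ∈ Metric.ball x r := by
      rw [mem_ball_iff_norm, ← sub_add_sub_cancel z' y x, hzy]
      refine (norm_add_le _ _).trans_lt ?_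
      rw [norm_smul, Real.norm_of_nonneg hs0.le, hsn]
      linarith
    have h1 := h.strong z' hz'r y hyr
    rw [hzy, inner_smul_right, norm_smul, Real.norm_of_nonneg hs0.le, hsn] at h1
    have h1' : c * (r / 2) * ‖z - y‖ ≤ inner ℝ (G z' - G y) (z - y) := by
      refine le_of_mul_le_mul_left ?_ hs0
      calc s * (c * (r / 2) * ‖z - y‖) = c * (r / 2) * (s * ‖z - y‖) := by ring
        _ = c * (r / 2) ^ 2 := by rw [hsn]; ring
        _ ≤ _ := h1
    have h2 : 0 ≤ inner ℝ (G z - G z') (z - y) := by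
      have h3 := hf.monotone hz (hr hz'r)
      rw [hzz, inner_smul_right] at h3
      rcases hs1.lt_or_eq with hs1 | hs1
      · exact nonneg_of_mul_nonneg_right h3 (by linarith)
      · have : z = z' := by rw [hz', hs1, one_smul]; abel
        rw [← this]; simp
    have e : G z - G y = (G z - G z') + (G z' - G y) := by abel
    rw [e, inner_add_left]
    linarith

/-- Near `x + G x` the map `Prox_{f*}`, which sends `q + G q` to `G q`, satisfies a strict form of
firm nonexpansiveness. -/
lemma prox_conjugate_strict (hf : IsLocallyStronglyConvex f D φ G) {x : E} (hx : x ∈ D) :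
    ∃ ε > 0, ∃ c > 0, ∀ u ∈ Metric.ball (x + G x) ε, ∀ u' ∈ Metric.ball (x + G x) ε,
      ‖prox (conjugate f) u - prox (conjugate f) u'‖ ^ 2 + c * ‖u - u'‖ ^ 2 ≤
        inner ℝ (prox (conjugate f) u - prox (conjugate f) u') (u - u') := by
  obtain ⟨r, c, L, hr, h⟩ := hf.strong x hx
  have hc0 := h.modulus_pos
  have hL0 := h.lipschitz_nonneg
  refine ⟨r, h.radius_pos, c / (1 + L) ^ 2, by positivity, ?_⟩
  -- `q + G q ↦ q` is nonexpansive, so it maps the ball around `x + G x` to the ball around `x`.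
  have hball : ∀ q ∈ D, q + G q ∈ Metric.ball (x + G x) r → q ∈ Metric.ball x r := by
    intro q hq hu
    rw [mem_ball_iff_norm] at hu ⊢
    refine lt_of_le_of_lt ?_ hu
    have hm := hf.monotone hq hx
    have e : q + G q - (x + G x) = (q - x) + (G q - G x) := by abel
    rw [e]
    have h1 : ‖q - x‖ ^ 2 ≤ ‖(q - x) + (G q - G x)‖ ^ 2 := by
      rw [norm_add_sq_real, real_inner_comm]
      linarith [sq_nonneg ‖G q - G x‖]
    exact le_of_sq_le_sq h1 (norm_nonneg _)
  intro u hu u' hu'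
  obtain ⟨q, hq, rfl⟩ := hf.onto u
  obtain ⟨q', hq', rfl⟩ := hf.onto u'
  have hqr := hball q hq hu
  have hqr' := hball q' hq' hu'
  rw [(hf.isSubgradient hq).prox_conjugate, (hf.isSubgradient hq').prox_conjugate]
  have e : q + G q - (q' + G q') = (q - q') + (G q - G q') := by abel
  rw [e, inner_add_right, real_inner_self_eq_norm_sq]
  have h1 := h.strong q hqr q' hqr'
  have h2 : ‖(q - q') + (G q - G q')‖ ≤ (1 + L) * ‖q - q'‖ := by
    have := h.lipschitz q hqr q' hqr'
    linarith [norm_add_le (q - q') (G q - G q')]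
  have h3 : ‖(q - q') + (G q - G q')‖ ^ 2 ≤ ((1 + L) * ‖q - q'‖) ^ 2 :=
    pow_le_pow_left₀ (norm_nonneg _) h2 2
  have h4 : c / (1 + L) ^ 2 * ‖(q - q') + (G q - G q')‖ ^ 2 ≤ c * ‖q - q'‖ ^ 2 := by
    calc c / (1 + L) ^ 2 * ‖(q - q') + (G q - G q')‖ ^ 2
        ≤ c / (1 + L) ^ 2 * ((1 + L) * ‖q - q'‖) ^ 2 := by gcongr
      _ = c * ‖q - q'‖ ^ 2 := by field_simp
  linarith

end IsLocallyStronglyConvex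

end LocallyStrong

/-! ### Stability of perturbed saddle point systems -/

section Stability

variable {E : Type*} [NormedAddCommGroup E] [InnerProductSpace ℝ E]

/-- `(Ω, Θ, X)` solves the KKT system, perturbed by `(U, V, W)`, of
`min {f(Ω) + g(Θ) | Ω - Θ = 0}`. -/
structure IsPerturbedKKT (f g : E → EReal) (u z : E × E × E) : Prop where
  left : IsSubgradient f z.1 (u.1 - z.2.2)
  right : IsSubgradient g z.2.1 (u.2.1 + z.2.2)
  feasible : z.2.1 = z.1 + u.2.2

namespace IsLocallyStronglyConvex

variable {f g : E → EReal} {D : Set E} {φ : E → ℝ} {G : E → E}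

/-- The basic estimate: monotonicity of `∂g` bounds `⟪G Ω - G Ω', Θ - Θ'⟫` from above. Since
`Θ - Θ' = Ω - (Ω' - (W - W'))`, strong monotonicity of `G` applies to the points `Ω` and
`Ω' - (W - W')`; only the second of them, which lies in the ball, is compared with `Ω'`. -/
lemma min_norm_le (hf : IsLocallyStronglyConvex f D φ G) {x : E} {r c L : ℝ}
    (hr : Metric.ball x r ⊆ D) (h : IsStrongOnBall G x r c L) {u u' z z' : E × E × E}
    (hz : IsPerturbedKKT f g u z) (hz' : IsPerturbedKKT f g u' z')
    (hx' : z'.1 ∈ Metric.ball x (r / 6)) (hW : ‖u.2.2 - u'.2.2‖ < r / 6) :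
    c * min ‖z.2.1 - z'.2.1‖ (r / 2) ≤
      ‖u.1 - u'.1‖ + ‖u.2.1 - u'.2.1‖ + L * ‖u.2.2 - u'.2.2‖ := by
  obtain ⟨U, V, W⟩ := u
  obtain ⟨U', V', W'⟩ := u'
  obtain ⟨Ω, Θ, X⟩ := z
  obtain ⟨Ω', Θ', X'⟩ := z'
  obtain ⟨h1, h2, h3⟩ := hz
  obtain ⟨h1', h2', h3'⟩ := hz'
  dsimp only at *
  rw [hf.isSubgradient_iff] at h1 h1'
  obtain ⟨hΩ, hG⟩ := h1
  obtain ⟨hΩ', hG'⟩ := h1'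
  have hr0 := h.radius_pos
  set d := Θ - Θ' with hd
  set y := Ω' - (W - W') with hy
  have hdy : Ω - y = d := by rw [hd, hy, h3, h3']; abel
  have hyx : y ∈ Metric.ball x (r / 3) := by
    rw [mem_ball_iff_norm] at hx' ⊢
    have e : y - x = (Ω' - x) - (W - W') := by rw [hy]; abel
    rw [e]
    exact (norm_sub_le _ _).trans_lt (by linarith)
  have hyr : y ∈ Metric.ball x r := Metric.ball_subset_ball (by linarith) hyx
  have hΩr : Ω' ∈ Metric.ball x r := Metric.ball_subset_ball (by linarith) hx'
  have k1 := hf.strong_of_mem hr h hyx hΩ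
  rw [hdy] at k1
  have k2 : ‖G y - G Ω'‖ ≤ L * ‖W - W'‖ := by
    have := h.lipschitz y hyr Ω' hΩr
    rwa [show y - Ω' = -(W - W') by rw [hy]; abel, norm_neg] at this
  have k3 := h2.monotone h2'
  rw [← hd] at k3
  have e : V + X - (V' + X') = ((U - U') + (V - V')) - ((G Ω - G y) + (G y - G Ω')) := by
    rw [← hG, ← hG']; abel
  rw [e, inner_sub_left, inner_add_left (G Ω - G y)] at k3
  have k4 := real_inner_le_norm ((U - U') + (V - V')) d
  have k5 := neg_le_of_abs_le (abs_real_inner_le_norm (G y - G Ω') d)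
  rcases eq_or_ne d 0 with hd0 | hd0
  · rw [hd0, norm_zero, min_eq_left (by linarith), mul_zero]
    have := h.lipschitz_nonneg
    positivity
  · refine le_of_mul_le_mul_right ?_ (norm_pos_iff.2 hd0)
    have k6 := norm_add_le (U - U') (V - V')
    calc c * min ‖d‖ (r / 2) * ‖d‖ ≤ inner ℝ (G Ω - G y) d := k1
      _ ≤ ‖(U - U') + (V - V')‖ * ‖d‖ + ‖G y - G Ω'‖ * ‖d‖ := by linarith
      _ ≤ (‖U - U'‖ + ‖V - V'‖) * ‖d‖ + (L * ‖W - W'‖) * ‖d‖ := by gcongr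
      _ = _ := by ring

/-- The perturbed system is solvable for small data: minimize
`Θ ↦ f(Θ - W) - ⟪U + V, Θ⟫ + g(Θ)` over a small closed ball around the unperturbed solution `x`;
strong monotonicity keeps the minimizer away from the boundary of the ball. -/
lemma exists_isPerturbedKKT [FiniteDimensional ℝ E] (hf : IsLocallyStronglyConvex f D φ G)
    (hbot : ∀ x, g x ≠ ⊥) (hclosed : LowerSemicontinuous g)
    (hconv : Convex ℝ {q : E × ℝ | g q.1 ≤ ((q.2 : ℝ) : EReal)}) {x : E} {r c L : ℝ}
    (hr : Metric.ball x r ⊆ D) (h : IsStrongOnBall G x r c L) (hx : IsSubgradient g x (-G x))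
    {u : E × E × E} (hW : ‖u.2.2‖ < r / 3)
    (hu : ‖u.1‖ + ‖u.2.1‖ + L * ‖u.2.2‖ < c * (r / 3)) : ∃ z, IsPerturbedKKT f g u z := by
  obtain ⟨U, V, W⟩ := u
  dsimp only at *
  have hr0 := h.radius_pos
  have hmem : ∀ y ∈ Metric.closedBall x (r / 3), y - W ∈ Metric.ball x r := by
    intro y hy
    rw [mem_closedBall_iff_norm] at hy
    rw [mem_ball_iff_norm, show y - W - x = (y - x) - W by abel]
    exact (norm_sub_le _ _).trans_lt (by linarith)
  set ψ : E → ℝ := fun y => φ (y - W) - inner ℝ (U + V) y with hψ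
  have hψc : ContinuousOn ψ (Metric.closedBall x (r / 3)) := by
    refine ContinuousOn.sub ?_ (by fun_prop)
    exact hf.continuousOn.comp (by fun_prop) fun y hy => hr (hmem y hy)
  obtain ⟨y, hy, hmin⟩ := exists_min_on_closedBall hclosed (by linarith : 0 ≤ r / 3) hψc
  have hyD : y - W ∈ D := hr (hmem y hy)
  have hxx : x ∈ Metric.closedBall x (r / 3) := Metric.mem_closedBall_self (by linarith)
  have hyt : g y ≠ ⊤ := by
    intro ht
    have h1 := hmin x hxx
    rw [ht, EReal.coe_add_top, top_le_iff] at h1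
    have h2 := hx.1
    have h3 := hx.2.1
    lift g x to ℝ using ⟨h2, h3⟩ with a
    rw [← EReal.coe_add] at h1
    exact EReal.coe_ne_top _ h1
  -- The optimality condition at `y` towards a point `x'`, near which the segment stays in the ball.
  have key : ∀ x', (∀ᶠ t in 𝓝[>] (0 : ℝ), y + t • (x' - y) ∈ Metric.closedBall x (r / 3)) →
      g y + ((inner ℝ (-(G (y - W) - (U + V))) (x' - y) : ℝ) : EReal) ≤ g x' := by
    intro x' hx'
    refine subgradient_inequality_of_min (φ := ψ) (G := fun y => G (y - W) - (U + V)) hbot hconv hyt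
      ?_ ?_ ?_
    · refine ContinuousAt.sub ?_ continuousAt_const
      exact ContinuousAt.comp (f := fun y => y - W) (hf.continuousAt hyD) (by fun_prop)
    · have hc : ContinuousAt (fun y => y - W) y := by fun_prop
      filter_upwards [hc.eventually (hf.isOpen.mem_nhds hyD)] with y' hy'
      have h1 := hf.gradient _ hy' _ hyD
      rw [show y - W - (y' - W) = y - y' by abel] at h1
      rw [inner_sub_left, hψ, inner_sub_right (U + V)]
      linarith
    · filter_upwards [hx'] with t ht
      exact hmin _ ht
  have hlt : ‖y - x‖ < r / 3 := by
    have h1 : g y + ((inner ℝ (-(G (y - W) - (U + V))) (x - y) : ℝ) : EReal) ≤ g x := by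
      refine key x ?_
      filter_upwards [Ioo_mem_nhdsGT (zero_lt_one (α := ℝ))] with t ht
      exact (convex_closedBall x (r / 3)).add_smul_sub_mem hy hxx ⟨ht.1.le, ht.2.le⟩
    have h2 := hx.2.2 y
    obtain ⟨a, ha⟩ : ∃ a : ℝ, g x = a := by
      have h2 := hx.1
      have h3 := hx.2.1
      lift g x to ℝ using ⟨h2, h3⟩ with a
      exact ⟨a, rfl⟩
    obtain ⟨b, hb⟩ : ∃ b : ℝ, g y = b := by
      have h3 := hbot y
      lift g y to ℝ using ⟨hyt, h3⟩ with b
      exact ⟨b, rfl⟩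
    rw [ha, hb, ← EReal.coe_add, EReal.coe_le_coe_iff] at h1 h2
    have hxW : x - W ∈ Metric.ball x r := hmem x hxx
    have k1 := h.strong (y - W) (hmem y hy) (x - W) hxW
    rw [show y - W - (x - W) = y - x by abel] at k1
    have k2 := h.lipschitz (x - W) hxW x (Metric.mem_ball_self hr0)
    rw [show x - W - x = -W by abel, norm_neg] at k2
    rw [show x - y = -(y - x) by abel, inner_neg_neg] at h1
    rw [inner_neg_left] at h2
    have e : G (y - W) - (U + V) = (G (y - W) - G (x - W)) + (G (x - W) - G x) + G x - U - V := by
      abel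
    rw [e, inner_sub_left, inner_sub_left, inner_add_left, inner_add_left] at h1
    have k3 := real_inner_le_norm U (y - x)
    have k4 := real_inner_le_norm V (y - x)
    have k5 := neg_le_of_abs_le (abs_real_inner_le_norm (G (x - W) - G x) (y - x))
    have k6 : ‖G (x - W) - G x‖ * ‖y - x‖ ≤ L * ‖W‖ * ‖y - x‖ := by gcongr
    have hc0 := h.modulus_pos
    rcases (norm_nonneg (y - x)).eq_or_lt with h0 | h0
    · rw [← h0]; linarith
    · have k7 : c * ‖y - x‖ * ‖y - x‖ ≤ (‖U‖ + ‖V‖ + L * ‖W‖) * ‖y - x‖ := by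
        linarith [sq ‖y - x‖]
      have k8 := le_of_mul_le_mul_right k7 h0
      exact lt_of_mul_lt_mul_left (k8.trans_lt hu) hc0.le
  refine ⟨(y - W, y, U - G (y - W)), ?_, ?_, ?_⟩
  · dsimp only
    rw [sub_sub_cancel]
    exact hf.isSubgradient hyD
  · refine ⟨hyt, hbot y, fun x' => ?_⟩
    dsimp only
    rw [show V + (U - G (y - W)) = -(G (y - W) - (U + V)) by abel]
    refine key x' ?_
    have hcont : ContinuousAt (fun t : ℝ => y + t • (x' - y)) 0 := by fun_prop
    have hev : ∀ᶠ t in 𝓝 (0 : ℝ), y + t • (x' - y) ∈ Metric.ball x (r / 3) :=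
      hcont.eventually (Metric.isOpen_ball.mem_nhds (by simpa [dist_eq_norm] using hlt))
    filter_upwards [nhdsWithin_le_nhds hev] with t ht
    exact Metric.ball_subset_closedBall ht
  · simp

/-- Solvability and Lipschitz stability of the perturbed system, in terms of a common bound `δ` on
the differences of the data. -/
theorem exists_lipschitz_perturbedKKT [FiniteDimensional ℝ E]
    (hf : IsLocallyStronglyConvex f D φ G)
    (hbot : ∀ x, g x ≠ ⊥) (hclosed : LowerSemicontinuous g)
    (hconv : Convex ℝ {q : E × ℝ | g q.1 ≤ ((q.2 : ℝ) : EReal)}) {x : E} (hxD : x ∈ D)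
    (hx : IsSubgradient g x (-G x)) :
    ∃ N ∈ 𝓝 (0 : E × E × E), ∃ κ : ℝ, 0 < κ ∧
      (∀ u ∈ N, ∃ z, IsPerturbedKKT f g u z) ∧
      ∀ u ∈ N, ∀ u' ∈ N, ∀ z z', IsPerturbedKKT f g u z → IsPerturbedKKT f g u' z' →
        ∀ δ : ℝ, ‖u.1 - u'.1‖ ≤ δ → ‖u.2.1 - u'.2.1‖ ≤ δ → ‖u.2.2 - u'.2.2‖ ≤ δ →
          ‖z.1 - z'.1‖ ≤ κ * δ ∧ ‖z.2.1 - z'.2.1‖ ≤ κ * δ ∧ ‖z.2.2 - z'.2.2‖ ≤ κ * δ := by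
  obtain ⟨r, c, L, hr, h⟩ := hf.strong x hxD
  have hr0 := h.radius_pos
  have hc0 := h.modulus_pos
  have hL0 := h.lipschitz_nonneg
  set ε : ℝ := min (r / 12) (c * (r / 24) / (2 + L)) with hε
  have hε0 : 0 < ε := by positivity
  have hε1 : ε ≤ r / 12 := min_le_left _ _
  have hε2 : (2 + L) * ε ≤ c * (r / 24) := by
    have : ε ≤ c * (r / 24) / (2 + L) := min_le_right _ _
    rw [le_div_iff₀ (by positivity)] at this
    linarith
  have hcr : 0 < c * r := by positivity
  have hN : ∀ u ∈ Metric.ball (0 : E × E × E) ε, ‖u.1‖ < ε ∧ ‖u.2.1‖ < ε ∧ ‖u.2.2‖ < ε := by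
    intro u hu
    rw [mem_ball_zero_iff] at hu
    exact ⟨(norm_fst_le u).trans_lt hu,
      ((norm_fst_le u.2).trans (norm_snd_le u)).trans_lt hu,
      ((norm_snd_le u.2).trans (norm_snd_le u)).trans_lt hu⟩
  have h00 : IsPerturbedKKT f g 0 (x, x, -G x) :=
    ⟨by simpa using hf.isSubgradient hxD, by simpa using hx, by simp⟩
  -- A first application, with the unperturbed solution, localizes all solutions.
  have hloc : ∀ u ∈ Metric.ball (0 : E × E × E) ε, ∀ z, IsPerturbedKKT f g u z →
      z.1 ∈ Metric.ball x (r / 6) := by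
    intro u hu z hz
    obtain ⟨h1, h2, h3⟩ := hN u hu
    have k := hf.min_norm_le hr h hz h00 (Metric.mem_ball_self (by positivity))
      (by simpa using h3.trans_le (by linarith))
    simp only [Prod.fst_zero, Prod.snd_zero, sub_zero] at k
    have k1 : L * ‖u.2.2‖ ≤ L * ε := by gcongr
    have k2 : c * min ‖z.2.1 - x‖ (r / 2) < c * (r / 12) := by linarith
    have k3 := lt_of_mul_lt_mul_left k2 hc0.le
    have k4 : ‖z.2.1 - x‖ < r / 12 := by
      rcases min_lt_iff.1 k3 with k | k
      · exact k
      · linarith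
    rw [mem_ball_iff_norm, show z.1 - x = (z.2.1 - x) - u.2.2 by rw [hz.feasible]; abel]
    exact (norm_sub_le _ _).trans_lt (by linarith)
  set κ₀ : ℝ := (2 + L) / c with hκ₀
  have hκ₀0 : 0 < κ₀ := by positivity
  refine ⟨Metric.ball 0 ε, Metric.ball_mem_nhds _ hε0, (1 + L) * (κ₀ + 1), by positivity,
    fun u hu => ?_, ?_⟩
  · obtain ⟨h1, h2, h3⟩ := hN u hu
    refine hf.exists_isPerturbedKKT hbot hclosed hconv hr h hx (by linarith) ?_
    have k1 : L * ‖u.2.2‖ ≤ L * ε := by gcongr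
    linarith
  · intro u hu u' hu' z z' hz hz' δ hδ1 hδ2 hδ3
    obtain ⟨h1, h2, h3⟩ := hN u hu
    obtain ⟨h1', h2', h3'⟩ := hN u' hu'
    have hδ0 : 0 ≤ δ := (norm_nonneg _).trans hδ1
    have n1 := norm_sub_le u.1 u'.1
    have n2 := norm_sub_le u.2.1 u'.2.1
    have n3 := norm_sub_le u.2.2 u'.2.2
    have k := hf.min_norm_le hr h hz hz' (hloc u' hu' z' hz') (by linarith)
    have k1 : L * ‖u.2.2 - u'.2.2‖ ≤ L * (2 * ε) := by gcongr; linarith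
    have k2 : c * min ‖z.2.1 - z'.2.1‖ (r / 2) < c * (r / 2) := by linarith
    have k3 : ‖z.2.1 - z'.2.1‖ < r / 2 := by
      rcases min_lt_iff.1 (lt_of_mul_lt_mul_left k2 hc0.le) with k | k
      · exact k
      · exact absurd k (lt_irrefl _)
    rw [min_eq_left k3.le] at k
    have k4 : L * ‖u.2.2 - u'.2.2‖ ≤ L * δ := by gcongr
    have b2 : ‖z.2.1 - z'.2.1‖ ≤ κ₀ * δ := by
      rw [hκ₀, div_mul_eq_mul_div, le_div_iff₀ hc0]
      linarith
    have b1 : ‖z.1 - z'.1‖ ≤ (κ₀ + 1) * δ := by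
      rw [show z.1 - z'.1 = (z.2.1 - z'.2.1) - (u.2.2 - u'.2.2) by
        rw [hz.feasible, hz'.feasible]; abel]
      exact (norm_sub_le _ _).trans (by linarith)
    have b3 : ‖z.2.2 - z'.2.2‖ ≤ δ + L * ((κ₀ + 1) * δ) := by
      have e := (hf.isSubgradient_iff.1 hz.left).2
      have e' := (hf.isSubgradient_iff.1 hz'.left).2
      rw [show z.2.2 - z'.2.2 = (u.1 - u'.1) - (G z.1 - G z'.1) by rw [← e, ← e']; abel]
      have hm := Metric.ball_subset_ball (by linarith : r / 6 ≤ r) (hloc u hu z hz)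
      have hm' := Metric.ball_subset_ball (by linarith : r / 6 ≤ r) (hloc u' hu' z' hz')
      have k5 := h.lipschitz _ hm _ hm'
      have k6 : L * ‖z.1 - z'.1‖ ≤ L * ((κ₀ + 1) * δ) := by gcongr
      exact (norm_sub_le _ _).trans (by linarith)
    have p1 : 0 ≤ κ₀ * δ := by positivity
    have p2 : 0 ≤ L * ((κ₀ + 1) * δ) := by positivity
    have e : (1 + L) * (κ₀ + 1) * δ = κ₀ * δ + δ + L * ((κ₀ + 1) * δ) := by ring
    rw [e]
    exact ⟨by linarith, by linarith, by linarith⟩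

end IsLocallyStronglyConvex

end Stability

/-! ### Clarke's generalized Jacobian of a map with constrained increments -/

section Clarke

variable {E F : Type*} [NormedAddCommGroup E] [NormedSpace ℝ E]
  [NormedAddCommGroup F] [NormedSpace ℝ F]

/-- If all increments `(x' - x, Φ x' - Φ x)` near a point lie in a closed cone `T` with convex
fibres, then so do all pairs `(h, J h)` with `J` in the generalized Jacobian: the property passes to
derivatives, to their limits, and to convex combinations. -/
lemma clarkeJacobian_graph_subset {Φ : E → F} {x : E} {T : Set (E × F)} (hT : IsClosed T)
    (hcone : ∀ t : ℝ, 0 < t → ∀ q ∈ T, t • q ∈ T) (hconv : ∀ h, Convex ℝ {k | (h, k) ∈ T})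
    (hΦ : ∃ N ∈ 𝓝 x, ∀ y ∈ N, ∀ y' ∈ N, (y' - y, Φ y' - Φ y) ∈ T)
    {J : E →L[ℝ] F} (hJ : J ∈ clarkeJacobian Φ x) (h : E) : (h, J h) ∈ T := by
  obtain ⟨N, hN, hΦ⟩ := hΦ
  have hC : Convex ℝ {J : E →L[ℝ] F | (h, J h) ∈ T} := by
    intro J₁ h₁ J₂ h₂ a b ha hb hab
    exact hconv h h₁ h₂ ha hb hab
  refine convexHull_min ?_ hC hJ
  rintro A ⟨v, hv, hd, hA⟩
  have hlim : Tendsto (fun m => (h, fderiv ℝ Φ (v m) h)) atTop (𝓝 (h, A h)) :=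
    tendsto_const_nhds.prodMk_nhds (((ContinuousLinearMap.apply ℝ F h).continuous.tendsto A).comp hA)
  refine hT.mem_of_tendsto hlim ?_
  filter_upwards [hv.eventually (eventually_mem_nhds_iff.2 hN)] with m hm
  have hslope := (hd m).hasFDerivAt.hasLineDerivAt h
  have hs := hslope.tendsto_slope_zero_right
  refine hT.mem_of_tendsto (tendsto_const_nhds.prodMk_nhds hs) ?_
  have hc : Tendsto (fun t : ℝ => v m + t • h) (𝓝[>] 0) (𝓝 (v m)) := by
    have : ContinuousAt (fun t : ℝ => v m + t • h) 0 := by fun_prop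
    have h2 : Tendsto (fun t : ℝ => v m + t • h) (𝓝 0) (𝓝 (v m)) := by
      simpa [ContinuousAt] using this
    exact h2.mono_left nhdsWithin_le_nhds
  filter_upwards [hc.eventually hm, self_mem_nhdsWithin] with t ht ht0
  have ht0' : (0 : ℝ) < t := ht0
  have := hcone t⁻¹ (inv_pos.2 ht0') _ (hΦ _ (mem_of_mem_nhds hm) _ ht)
  simpa [ht0'.ne'] using this

end Clarke

/-! ### Positive definite matrices and the log-determinant -/

section LogDet

open Matrix
open scoped Matrix.Norms.Frobenius

variable {m : Type*} [Fintype m]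

lemma frobenius_norm_sq (A : Matrix m m ℝ) : ‖A‖ ^ 2 = ∑ i, ∑ j, A i j ^ 2 := by
  rw [Matrix.frobenius_norm_def, ← Real.rpow_natCast, ← Real.rpow_mul (by positivity)]
  norm_num

lemma trace_transpose_mul_self (A : Matrix m m ℝ) : (Aᵀ * A).trace = ‖A‖ ^ 2 := by
  rw [frobenius_norm_sq, Finset.sum_comm]
  simp [Matrix.trace, Matrix.mul_apply, sq]

lemma trace_le_card_mul_norm (A : Matrix m m ℝ) : A.trace ≤ Fintype.card m * ‖A‖ := by
  have h : ∀ i, A i i ≤ ‖A‖ := fun i => by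
    refine le_of_sq_le_sq ?_ (norm_nonneg _)
    rw [frobenius_norm_sq]
    exact (Finset.single_le_sum (f := fun j => A i j ^ 2) (fun j _ => sq_nonneg _)
      (Finset.mem_univ i)).trans
      (Finset.single_le_sum (f := fun i => ∑ j, A i j ^ 2)
        (fun i _ => Finset.sum_nonneg fun j _ => sq_nonneg _) (Finset.mem_univ i))
  calc A.trace ≤ ∑ _i : m, ‖A‖ := Finset.sum_le_sum fun i _ => h i
    _ = _ := by simp

lemma abs_dotProduct_mulVec_le (A : Matrix m m ℝ) (x : m → ℝ) :
    |x ⬝ᵥ (A *ᵥ x)| ≤ ‖A‖ * (x ⬝ᵥ x) := by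
  have hx : x ⬝ᵥ x = ‖WithLp.toLp 2 x‖ ^ 2 := by
    rw [EuclideanSpace.norm_sq_eq]; simp [dotProduct, sq]
  have h1 : x ⬝ᵥ (A *ᵥ x) = inner ℝ (WithLp.toLp 2 (A *ᵥ x)) (WithLp.toLp 2 x) := by
    simp [PiLp.inner_apply, dotProduct]
  have h2 : ‖WithLp.toLp 2 (A *ᵥ x)‖ ≤ ‖A‖ * ‖WithLp.toLp 2 x‖ := by
    have := Matrix.frobenius_norm_mul A (replicateCol Unit x)
    rwa [← Matrix.replicateCol_mulVec, Matrix.frobenius_norm_replicateCol,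
      Matrix.frobenius_norm_replicateCol] at this
  rw [h1, hx]
  calc _ ≤ ‖WithLp.toLp 2 (A *ᵥ x)‖ * ‖WithLp.toLp 2 x‖ := abs_real_inner_le_norm _ _
    _ ≤ ‖A‖ * ‖WithLp.toLp 2 x‖ * ‖WithLp.toLp 2 x‖ := by gcongr
    _ = _ := by ring

variable [DecidableEq m]

lemma exists_eq_transpose_mul_self {A : Matrix m m ℝ} (hA : A.PosDef) :
    ∃ C : Matrix m m ℝ, IsUnit C.det ∧ A = Cᵀ * C := by
  open scoped MatrixOrder in
  obtain ⟨C, hC, rfl⟩ := CStarAlgebra.isStrictlyPositive_iff_eq_star_mul_self.mp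
    hA.isStrictlyPositive
  exact ⟨C, (Matrix.isUnit_iff_isUnit_det C).1 hC, by simp [star_eq_conjTranspose]⟩

lemma isUnit_det_of_posDef {A : Matrix m m ℝ} (hA : A.PosDef) : IsUnit A.det :=
  (Matrix.isUnit_iff_isUnit_det A).1 hA.isUnit

/-- Congruence by `C⁻¹`, where `A = Cᵀ C`, reduces the comparison of `B` with `A` to the comparison
of `C⁻ᵀ B C⁻¹` with the identity matrix. -/
lemma transpose_inv_mul_mul_inv_mul {B C : Matrix m m ℝ} (hC : IsUnit C.det) :
    Cᵀ * (C⁻¹ᵀ * B * C⁻¹) * C = B := by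
  have h1 : Cᵀ * C⁻¹ᵀ = 1 := by rw [← transpose_mul, nonsing_inv_mul _ hC, transpose_one]
  calc Cᵀ * (C⁻¹ᵀ * B * C⁻¹) * C = (Cᵀ * C⁻¹ᵀ) * B * (C⁻¹ * C) := by noncomm_ring
    _ = B := by rw [h1, nonsing_inv_mul _ hC]; simp

/-- Positive definiteness is an open condition among Hermitian matrices. -/
lemma exists_forall_norm_sub_lt_posDef {A : Matrix m m ℝ} (hA : A.PosDef) :
    ∃ ε > 0, ∀ B : Matrix m m ℝ, B.IsHermitian → ‖B - A‖ < ε → B.PosDef := by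
  obtain ⟨C, hC, rfl⟩ := exists_eq_transpose_mul_self hA
  refine ⟨1 / (‖C⁻¹‖ ^ 2 + 1), by positivity, fun B hB hlt => ?_⟩
  rw [lt_div_iff₀ (by positivity)] at hlt
  refine PosDef.of_dotProduct_mulVec_pos hB fun x hx => ?_
  rw [star_trivial]
  set y := C *ᵥ x with hy
  have hxy : x = C⁻¹ *ᵥ y := by rw [hy, mulVec_mulVec, nonsing_inv_mul _ hC, one_mulVec]
  have hy0 : y ≠ 0 := fun h => hx (by rw [hxy, h, mulVec_zero])
  have hyy : 0 < y ⬝ᵥ y := by simpa using dotProduct_star_self_pos_iff.2 hy0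
  have h1 : x ⬝ᵥ (B *ᵥ x) = y ⬝ᵥ y + x ⬝ᵥ ((B - Cᵀ * C) *ᵥ x) := by
    rw [sub_mulVec, dotProduct_sub, ← mulVec_mulVec, ← hy, mulVec_transpose, dotProduct_comm x
      (y ᵥ* C), ← dotProduct_mulVec, ← hy]
    ring
  have h2 : x ⬝ᵥ ((B - Cᵀ * C) *ᵥ x) = y ⬝ᵥ ((C⁻¹ᵀ * (B - Cᵀ * C) * C⁻¹) *ᵥ y) := by
    rw [← mulVec_mulVec, ← mulVec_mulVec, ← hxy, mulVec_transpose, dotProduct_comm y,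
      ← dotProduct_mulVec, ← hxy, dotProduct_comm]
  have h3 := neg_le_of_abs_le (abs_dotProduct_mulVec_le (C⁻¹ᵀ * (B - Cᵀ * C) * C⁻¹) y)
  have h4 : ‖C⁻¹ᵀ * (B - Cᵀ * C) * C⁻¹‖ < 1 := by
    calc ‖C⁻¹ᵀ * (B - Cᵀ * C) * C⁻¹‖ ≤ ‖C⁻¹ᵀ‖ * ‖B - Cᵀ * C‖ * ‖C⁻¹‖ :=
          (norm_mul_le _ _).trans (by gcongr; exact norm_mul_le _ _)
      _ = ‖B - Cᵀ * C‖ * ‖C⁻¹‖ ^ 2 := by rw [Matrix.frobenius_norm_transpose]; ring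
      _ < 1 := by linarith [norm_nonneg (B - Cᵀ * C)]
  rw [h1, h2]
  have h5 : ‖C⁻¹ᵀ * (B - Cᵀ * C) * C⁻¹‖ * (y ⬝ᵥ y) < 1 * (y ⬝ᵥ y) := by gcongr
  linarith

/-- The gradient inequality of the concave function `log det`. It amounts to `log μ ≤ μ - 1` for the
eigenvalues `μ` of `C⁻ᵀ B C⁻¹`, where `A = Cᵀ C`. -/
lemma log_det_le {A B : Matrix m m ℝ} (hA : A.PosDef) (hB : B.PosDef) :
    Real.log B.det ≤ Real.log A.det + (A⁻¹ * (B - A)).trace := by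
  obtain ⟨C, hC, rfl⟩ := exists_eq_transpose_mul_self hA
  set N := C⁻¹ᵀ * B * C⁻¹ with hN
  have hCu : IsUnit C⁻¹ := by
    rw [Matrix.isUnit_iff_isUnit_det]; exact (Matrix.isUnit_nonsing_inv_det_iff).2 hC
  have hNp : N.PosDef := by
    have := (Matrix.IsUnit.posDef_star_left_conjugate_iff hCu (x := B)).2 hB
    simpa [hN, star_eq_conjTranspose] using this
  have hBN : B = Cᵀ * N * C := (transpose_inv_mul_mul_inv_mul hC).symm
  have hCd : C.det ≠ 0 := hC.ne_zero
  have hdet : Real.log B.det = Real.log (Cᵀ * C).det + Real.log N.det := by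
    have : B.det = (Cᵀ * C).det * N.det := by
      rw [hBN]; simp only [det_mul]; ring
    rw [this, Real.log_mul (by simp [hCd]) hNp.det_pos.ne']
  have htr : ((Cᵀ * C)⁻¹ * (B - Cᵀ * C)).trace = N.trace - Fintype.card m := by
    have hu : IsUnit (Cᵀ * C).det := by simp [det_mul, hCd]
    rw [mul_sub, nonsing_inv_mul _ hu, trace_sub, trace_one, Matrix.mul_inv_rev,
      ← transpose_nonsing_inv, hN, Matrix.mul_assoc, trace_mul_comm C⁻¹]
  have hlog : Real.log N.det ≤ N.trace - Fintype.card m := by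
    rw [hNp.1.det_eq_prod_eigenvalues, hNp.1.trace_eq_sum_eigenvalues]
    simp only [RCLike.ofReal_real_eq_id, id_eq]
    rw [Real.log_prod (fun i _ => (hNp.eigenvalues_pos i).ne')]
    calc ∑ i, Real.log (hNp.1.eigenvalues i) ≤ ∑ i, (hNp.1.eigenvalues i - 1) :=
          Finset.sum_le_sum fun i _ => Real.log_le_sub_one_of_pos (hNp.eigenvalues_pos i)
      _ = _ := by simp [Finset.sum_sub_distrib]
  linarith

lemma inv_sub_inv_eq {A B : Matrix m m ℝ} (hA : A.PosDef) (hB : B.PosDef) :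
    B⁻¹ - A⁻¹ = B⁻¹ * (A - B) * A⁻¹ := by
  rw [mul_sub, sub_mul, nonsing_inv_mul _ (isUnit_det_of_posDef hB), Matrix.mul_assoc,
    mul_nonsing_inv _ (isUnit_det_of_posDef hA), mul_one, one_mul]

/-- Strong monotonicity of `A ↦ -A⁻¹`: with `A = Cᵀ C` and `B = Eᵀ E`, the trace on the right is
`‖E⁻ᵀ Δ C⁻¹‖²` for `Δ = A - B`, while `‖C‖² = trace A` and `‖E‖² = trace B`. -/
lemma norm_sub_sq_le_trace {A B : Matrix m m ℝ} (hA : A.PosDef) (hB : B.PosDef) :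
    ‖A - B‖ ^ 2 ≤ A.trace * B.trace * ((B⁻¹ - A⁻¹) * (A - B)).trace := by
  rw [inv_sub_inv_eq hA hB]
  have hΔ : (A - B)ᵀ = A - B := by
    have := hA.1.sub hB.1
    rwa [IsHermitian, conjTranspose_eq_transpose_of_trivial] at this
  set Δ := A - B with hΔdef
  clear_value Δ
  obtain ⟨C, hC, rfl⟩ := exists_eq_transpose_mul_self hA
  obtain ⟨E, hE, rfl⟩ := exists_eq_transpose_mul_self hB
  set N := E⁻¹ᵀ * Δ * C⁻¹ with hN
  have hΔN : Δ = Eᵀ * N * C := by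
    have h1 : Eᵀ * E⁻¹ᵀ = 1 := by rw [← transpose_mul, nonsing_inv_mul _ hE, transpose_one]
    calc Δ = (Eᵀ * E⁻¹ᵀ) * Δ * (C⁻¹ * C) := by rw [h1, nonsing_inv_mul _ hC]; simp
      _ = _ := by rw [hN]; noncomm_ring
  have htr : ((Eᵀ * E)⁻¹ * Δ * (Cᵀ * C)⁻¹ * Δ).trace = ‖N‖ ^ 2 := by
    rw [← trace_transpose_mul_self, Matrix.mul_inv_rev, Matrix.mul_inv_rev,
      ← transpose_nonsing_inv, ← transpose_nonsing_inv, hN]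
    simp only [transpose_mul, transpose_transpose, hΔ]
    calc (E⁻¹ * E⁻¹ᵀ * Δ * (C⁻¹ * C⁻¹ᵀ) * Δ).trace
        = ((E⁻¹ * E⁻¹ᵀ * Δ * C⁻¹) * (C⁻¹ᵀ * Δ)).trace := by congr 1; noncomm_ring
      _ = ((C⁻¹ᵀ * Δ) * (E⁻¹ * E⁻¹ᵀ * Δ * C⁻¹)).trace := trace_mul_comm _ _
      _ = _ := by congr 1; noncomm_ring
  rw [htr, trace_transpose_mul_self, trace_transpose_mul_self]
  calc ‖Δ‖ ^ 2 = ‖Eᵀ * N * C‖ ^ 2 := by rw [← hΔN]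
    _ ≤ (‖Eᵀ‖ * ‖N‖ * ‖C‖) ^ 2 := by
        gcongr
        exact (norm_mul_le _ _).trans (by gcongr; exact norm_mul_le _ _)
    _ = _ := by rw [Matrix.frobenius_norm_transpose]; ring

lemma norm_inv_sub_inv_le {A B : Matrix m m ℝ} (hA : A.PosDef) (hB : B.PosDef) :
    ‖B⁻¹ - A⁻¹‖ ≤ ‖B⁻¹‖ * ‖A⁻¹‖ * ‖A - B‖ := by
  rw [inv_sub_inv_eq hA hB]
  calc ‖B⁻¹ * (A - B) * A⁻¹‖ ≤ ‖B⁻¹‖ * ‖A - B‖ * ‖A⁻¹‖ :=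
        (norm_mul_le _ _).trans (by gcongr; exact norm_mul_le _ _)
    _ = _ := by ring

lemma norm_inv_le {A B : Matrix m m ℝ} (hA : A.PosDef) (hB : B.PosDef)
    (h : ‖A⁻¹‖ * ‖A - B‖ ≤ 1 / 2) : ‖B⁻¹‖ ≤ 2 * ‖A⁻¹‖ := by
  have h1 := norm_inv_sub_inv_le hA hB
  have h2 : ‖B⁻¹‖ ≤ ‖B⁻¹ - A⁻¹‖ + ‖A⁻¹‖ := by
    simpa using norm_add_le (B⁻¹ - A⁻¹) A⁻¹
  have h3 : ‖B⁻¹‖ * (‖A⁻¹‖ * ‖A - B‖) ≤ ‖B⁻¹‖ * (1 / 2) := by gcongr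
  linarith

/-- The equation `Q - Q⁻¹ = M`, for symmetric `M`, has a positive definite solution: apply
`t ↦ (t + √(t² + 4)) / 2` to the eigenvalues of `M`. -/
lemma exists_posDef_sub_inv_eq {M : Matrix m m ℝ} (hM : M.IsHermitian) :
    ∃ Q : Matrix m m ℝ, Q.PosDef ∧ Q - Q⁻¹ = M := by
  set γ : m → ℝ := fun i => (hM.eigenvalues i + √(hM.eigenvalues i ^ 2 + 4)) / 2 with hγ
  have hpos : ∀ i, 0 < γ i := fun i => by
    have h1 : |hM.eigenvalues i| < √(hM.eigenvalues i ^ 2 + 4) := by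
      rw [← Real.sqrt_sq_eq_abs]
      exact Real.sqrt_lt_sqrt (sq_nonneg _) (by linarith)
    have := neg_abs_le (hM.eigenvalues i)
    simp only [hγ]
    linarith
  have heq : ∀ i, γ i - (γ i)⁻¹ = hM.eigenvalues i := fun i => by
    have h1 := Real.sq_sqrt (by positivity : 0 ≤ hM.eigenvalues i ^ 2 + 4)
    have h2 : γ i * γ i = hM.eigenvalues i * γ i + 1 := by
      simp only [hγ]
      nlinarith
    have h3 := (hpos i).ne'
    field_simp
    linarith
  set U := Unitary.conjStarAlgAut ℝ (Matrix m m ℝ) hM.eigenvectorUnitary with hU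
  have hinv : (U (diagonal γ))⁻¹ = U (diagonal fun i => (γ i)⁻¹) := by
    refine Matrix.inv_eq_right_inv ?_
    rw [← map_mul, diagonal_mul_diagonal, ← map_one U]
    congr 1
    simp [(hpos _).ne']
  refine ⟨U (diagonal γ), ?_, ?_⟩
  · rw [hU, Unitary.conjStarAlgAut_apply]
    exact (Matrix.IsUnit.posDef_star_right_conjugate_iff
      (Unitary.isUnit_coe (U := hM.eigenvectorUnitary))).2 (PosDef.diagonal hpos)
  · rw [hinv, ← map_sub, diagonal_sub]
    conv_rhs => rw [hM.spectral_theorem]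
    rw [hU]
    congr 2
    funext i
    simpa using heq i

end LogDet

/-! ### Tuples of symmetric matrices -/

section Tuples

open Matrix
open scoped Matrix.Norms.Frobenius

variable {p K : ℕ}

@[simp]
lemma mat_apply (X : SymTuple p K) (k : Fin K) (i j : Fin p) : X.mat k i j = X.1 (k, i, j) := rfl

lemma mat_add (X Y : SymTuple p K) (k : Fin K) : (X + Y).mat k = X.mat k + Y.mat k := rfl

lemma mat_sub (X Y : SymTuple p K) (k : Fin K) : (X - Y).mat k = X.mat k - Y.mat k := rfl

lemma transpose_mat (X : SymTuple p K) (k : Fin K) : (X.mat k)ᵀ = X.mat k := by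
  ext i j
  exact X.2 k j i

lemma isHermitian_mat (X : SymTuple p K) (k : Fin K) : (X.mat k).IsHermitian := by
  rw [IsHermitian, conjTranspose_eq_transpose_of_trivial, transpose_mat]

/-- The tuple with prescribed symmetric components. -/
def SymTuple.ofMat (M : Fin K → Matrix (Fin p) (Fin p) ℝ) (hM : ∀ k, (M k)ᵀ = M k) :
    SymTuple p K :=
  ⟨WithLp.toLp 2 fun q => M q.1 q.2.1 q.2.2, fun k i j => congrFun (congrFun (hM k) j) i⟩

@[simp]
lemma mat_ofMat (M : Fin K → Matrix (Fin p) (Fin p) ℝ) (hM : ∀ k, (M k)ᵀ = M k) (k : Fin K) :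
    (SymTuple.ofMat M hM).mat k = M k := rfl

lemma ext_mat {X Y : SymTuple p K} (h : ∀ k, X.mat k = Y.mat k) : X = Y := by
  apply Subtype.ext
  ext q
  exact congrFun (congrFun (h q.1) q.2.1) q.2.2

/-- The tuple of the inverse matrices. -/
noncomputable def SymTuple.inv (X : SymTuple p K) : SymTuple p K :=
  SymTuple.ofMat (fun k => (X.mat k)⁻¹) fun k => by rw [transpose_nonsing_inv, transpose_mat]

@[simp]
lemma mat_inv (X : SymTuple p K) (k : Fin K) : X.inv.mat k = (X.mat k)⁻¹ := rfl

lemma inner_eq_sum_trace (X Y : SymTuple p K) :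
    inner ℝ X Y = ∑ k, (X.mat k * Y.mat k).trace := by
  rw [Submodule.coe_inner, PiLp.inner_apply, Fintype.sum_prod_type]
  refine Finset.sum_congr rfl fun k _ => ?_
  rw [Fintype.sum_prod_type]
  refine Finset.sum_congr rfl fun i _ => ?_
  rw [Matrix.diag_apply, Matrix.mul_apply]
  refine Finset.sum_congr rfl fun j _ => ?_
  rw [mat_apply, mat_apply, Y.2 k j i]
  simp [mul_comm]

lemma norm_sq_eq_sum (X : SymTuple p K) : ‖X‖ ^ 2 = ∑ k, ‖X.mat k‖ ^ 2 := by
  rw [← real_inner_self_eq_norm_sq, inner_eq_sum_trace]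
  refine Finset.sum_congr rfl fun k _ => ?_
  rw [← trace_transpose_mul_self, transpose_mat]

lemma norm_mat_le (X : SymTuple p K) (k : Fin K) : ‖X.mat k‖ ≤ ‖X‖ := by
  refine le_of_sq_le_sq ?_ (norm_nonneg _)
  rw [norm_sq_eq_sum]
  exact Finset.single_le_sum (f := fun k => ‖X.mat k‖ ^ 2) (fun k _ => sq_nonneg _)
    (Finset.mem_univ k)

lemma norm_le_of_norm_mat_le {X Y : SymTuple p K} {L : ℝ} (hL : 0 ≤ L)
    (h : ∀ k, ‖X.mat k‖ ≤ L * ‖Y.mat k‖) : ‖X‖ ≤ L * ‖Y‖ := by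
  refine le_of_sq_le_sq ?_ (by positivity)
  rw [mul_pow, norm_sq_eq_sum, norm_sq_eq_sum, Finset.mul_sum]
  refine Finset.sum_le_sum fun k _ => ?_
  rw [← mul_pow]
  exact pow_le_pow_left₀ (norm_nonneg _) (h k) 2

lemma continuous_mat (k : Fin K) : Continuous fun X : SymTuple p K => X.mat k := by
  refine continuous_matrix fun i j => ?_
  simp only [mat_apply]
  fun_prop

/-! ### The log-determinant loss -/

/-- The domain of the loss: tuples of positive definite matrices. -/
def posDefTuples (p K : ℕ) : Set (SymTuple p K) :=
  {X | ∀ k, (X.mat k).PosDef}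

/-- The real valued loss `∑ₖ (-log det Θ⁽ᵏ⁾ + ⟪S⁽ᵏ⁾, Θ⁽ᵏ⁾⟫)`. -/
noncomputable def realLoss (S Θ : SymTuple p K) : ℝ :=
  ∑ k, (-Real.log (Θ.mat k).det + ((S.mat k)ᵀ * Θ.mat k).trace)

lemma coe_sum_ereal {ι : Type*} (s : Finset ι) (a : ι → ℝ) :
    ((∑ i ∈ s, a i : ℝ) : EReal) = ∑ i ∈ s, (a i : EReal) := by
  classical
  induction s using Finset.induction_on with
  | empty => simp
  | insert i s hi ih => rw [Finset.sum_insert hi, Finset.sum_insert hi, EReal.coe_add, ih]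

lemma sum_ereal_eq_top {ι : Type*} {s : Finset ι} {a : ι → EReal} (hb : ∀ i, a i ≠ ⊥)
    {i : ι} (hi : i ∈ s) (ht : a i = ⊤) : ∑ i ∈ s, a i = ⊤ := by
  classical
  have hne : ∀ t : Finset ι, ∑ i ∈ t, a i ≠ ⊥ := by
    intro t
    induction t using Finset.induction_on with
    | empty => simp
    | insert j t hj ih =>
      rw [Finset.sum_insert hj]
      simp [EReal.add_eq_bot_iff, hb j, ih]
  rw [← Finset.add_sum_erase s a hi, ht, EReal.top_add_of_ne_bot (hne _)]

lemma loss_eq_coe (S : SymTuple p K) {Θ : SymTuple p K} (hΘ : Θ ∈ posDefTuples p K) :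
    loss S Θ = realLoss S Θ := by
  rw [loss, realLoss, coe_sum_ereal]
  refine Finset.sum_congr rfl fun k _ => ?_
  rw [negLogDet, if_pos (hΘ k), EReal.coe_add]

lemma loss_eq_top (S : SymTuple p K) {Θ : SymTuple p K} (hΘ : Θ ∉ posDefTuples p K) :
    loss S Θ = ⊤ := by
  obtain ⟨k, hk⟩ : ∃ k, ¬ (Θ.mat k).PosDef := by simpa [posDefTuples] using hΘ
  refine sum_ereal_eq_top (fun k => ?_) (Finset.mem_univ k) ?_
  · rw [negLogDet]
    split_ifs
    · rw [← EReal.coe_add]; exact EReal.coe_ne_bot _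
    · rw [EReal.top_add_coe]; simp
  · rw [negLogDet, if_neg hk, EReal.top_add_coe]

lemma isOpen_posDefTuples : IsOpen (posDefTuples p K) := by
  rw [posDefTuples, Set.ofPred_forall]
  refine isOpen_iInter_of_finite fun k => ?_
  rw [Metric.isOpen_iff]
  intro X hX
  obtain ⟨ε, hε, h⟩ := exists_forall_norm_sub_lt_posDef (A := X.mat k) hX
  refine ⟨ε, hε, fun Y hY => h _ (isHermitian_mat Y k) ?_⟩
  rw [← mat_sub]
  exact (norm_mat_le _ k).trans_lt (mem_ball_iff_norm.1 hY)

lemma continuousOn_realLoss (S : SymTuple p K) : ContinuousOn (realLoss S) (posDefTuples p K) := by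
  unfold realLoss
  refine continuousOn_finsetSum _ fun k _ => ContinuousOn.add (ContinuousOn.neg ?_) ?_
  · exact ContinuousOn.log ((continuous_mat k).matrix_det.continuousOn)
      fun X hX => (hX k).det_pos.ne'
  · exact (Continuous.matrix_trace (continuous_const.matrix_mul (continuous_mat k))).continuousOn

lemma realLoss_gradient (S : SymTuple p K) {X Y : SymTuple p K} (hX : X ∈ posDefTuples p K)
    (hY : Y ∈ posDefTuples p K) :
    realLoss S X + inner ℝ (S - X.inv) (Y - X) ≤ realLoss S Y := by
  rw [inner_eq_sum_trace, realLoss, realLoss, ← Finset.sum_add_distrib]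
  refine Finset.sum_le_sum fun k _ => ?_
  have h := log_det_le (hX k) (hY k)
  rw [transpose_mat, mat_sub, mat_sub, mat_inv, sub_mul, trace_sub, mul_sub (S.mat k), trace_sub]
  linarith

/-- Explicit radius and constants for the local strong monotonicity of `X ↦ S - X⁻¹`. -/
lemma isStrongOnBall_sub_inv (S : SymTuple p K) {X : SymTuple p K} {r : ℝ} (hr0 : 0 < r)
    (hr : Metric.ball X r ⊆ posDefTuples p K) (hr1 : r ≤ 1 / (2 * (‖X.inv‖ + 1))) :
    IsStrongOnBall (fun Y => S - Y.inv) X r (1 / (p * (‖X‖ + 1) + 1) ^ 2) ((2 * ‖X.inv‖) ^ 2) := by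
  have hX : X ∈ posDefTuples p K := hr (Metric.mem_ball_self hr0)
  have hrle : r ≤ 1 := by
    refine hr1.trans ((div_le_one (by positivity)).2 ?_)
    linarith [norm_nonneg X.inv]
  have e : ∀ Y Z : SymTuple p K, S - Y.inv - (S - Z.inv) = Z.inv - Y.inv := fun Y Z => by abel
  refine ⟨hr0, by positivity, by positivity, fun Y hY Z hZ => ?_, fun Y hY Z hZ => ?_⟩
  · have htr : ∀ Y ∈ Metric.ball X r, ∀ k,
        0 ≤ (Y.mat k).trace ∧ (Y.mat k).trace ≤ p * (‖X‖ + 1) + 1 := by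
      intro Y hY k
      refine ⟨(hr hY k).posSemidef.trace_nonneg, ?_⟩
      have h1 := trace_le_card_mul_norm (Y.mat k)
      rw [Fintype.card_fin] at h1
      have h2 : ‖Y.mat k‖ ≤ ‖X‖ + 1 := by
        have := norm_mat_le Y k
        have h3 := norm_add_le (Y - X) X
        rw [sub_add_cancel] at h3
        have := mem_ball_iff_norm.1 hY
        linarith
      have h3 : (p : ℝ) * ‖Y.mat k‖ ≤ p * (‖X‖ + 1) := by gcongr
      linarith
    rw [e, div_mul_eq_mul_div, one_mul, div_le_iff₀ (by positivity), norm_sq_eq_sum,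
      inner_eq_sum_trace, Finset.sum_mul]
    refine Finset.sum_le_sum fun k _ => ?_
    have h1 := norm_sub_sq_le_trace (hr hY k) (hr hZ k)
    rw [mat_sub, mat_sub, mat_inv, mat_inv]
    obtain ⟨ya, yb⟩ := htr Y hY k
    obtain ⟨za, zb⟩ := htr Z hZ k
    set T := (((Z.mat k)⁻¹ - (Y.mat k)⁻¹) * (Y.mat k - Z.mat k)).trace with hT
    -- Adding the two gradient inequalities of `log det` gives `0 ≤ T`.
    have hT0 : 0 ≤ T := by
      have g1 := log_det_le (hr hY k) (hr hZ k)
      have g2 := log_det_le (hr hZ k) (hr hY k)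
      have g3 : T = ((Y.mat k)⁻¹ * (Z.mat k - Y.mat k)).trace +
          ((Z.mat k)⁻¹ * (Y.mat k - Z.mat k)).trace := by
        rw [hT, sub_mul, trace_sub, ← neg_sub (Y.mat k) (Z.mat k), mul_neg, trace_neg]
        ring
      linarith
    calc _ ≤ (Y.mat k).trace * (Z.mat k).trace * T := h1
      _ ≤ ((p * (‖X‖ + 1) + 1) * (p * (‖X‖ + 1) + 1)) * T := by gcongr
      _ = _ := by ring
  · have hinv : ∀ Y ∈ Metric.ball X r, ∀ k, ‖(Y.mat k)⁻¹‖ ≤ 2 * ‖X.inv‖ := by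
      intro Y hY k
      have h0 : ‖(X.mat k)⁻¹‖ ≤ ‖X.inv‖ := norm_mat_le X.inv k
      refine (norm_inv_le (hX k) (hr hY k) ?_).trans (by linarith)
      have h1 : ‖X.mat k - Y.mat k‖ ≤ 1 / (2 * (‖X.inv‖ + 1)) := by
        rw [← mat_sub]
        refine (norm_mat_le _ k).trans (le_trans ?_ hr1)
        rw [norm_sub_rev]
        exact (mem_ball_iff_norm.1 hY).le
      calc ‖(X.mat k)⁻¹‖ * ‖X.mat k - Y.mat k‖
          ≤ (‖X.inv‖ + 1) * (1 / (2 * (‖X.inv‖ + 1))) := by gcongr; linarith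
        _ = 1 / 2 := by field_simp
    rw [e]
    refine norm_le_of_norm_mat_le (by positivity) fun k => ?_
    rw [mat_sub, mat_inv, mat_inv, mat_sub]
    refine (norm_inv_sub_inv_le (hr hY k) (hr hZ k)).trans ?_
    rw [sq]
    have := hinv Y hY k
    have := hinv Z hZ k
    gcongr

lemma exists_add_sub_inv_eq (S U : SymTuple p K) :
    ∃ Q ∈ posDefTuples p K, Q + (S - Q.inv) = U := by
  choose Q hQ hQU using fun k => exists_posDef_sub_inv_eq (isHermitian_mat (U - S) k)
  refine ⟨SymTuple.ofMat Q fun k => ?_, hQ, ext_mat fun k => ?_⟩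
  · have := (hQ k).1
    rwa [IsHermitian, conjTranspose_eq_transpose_of_trivial] at this
  · have := hQU k
    rw [mat_sub] at this
    rw [mat_add, mat_sub, mat_inv, mat_ofMat, add_sub_left_comm, this]
    abel

lemma isLocallyStronglyConvex_loss (S : SymTuple p K) :
    IsLocallyStronglyConvex (loss S) (posDefTuples p K) (realLoss S) (fun X => S - X.inv) where
  isOpen := isOpen_posDefTuples
  coe_eq _ h := loss_eq_coe S h
  eq_top _ h := loss_eq_top S h
  gradient _ hX _ hY := realLoss_gradient S hX hY
  continuousOn := continuousOn_realLoss S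
  strong X hX := by
    obtain ⟨r, hr0, hr⟩ := Metric.isOpen_iff.1 isOpen_posDefTuples X hX
    set r' := min r (1 / (2 * (‖X.inv‖ + 1))) with hr'
    have hsub : Metric.ball X r' ⊆ posDefTuples p K :=
      (Metric.ball_subset_ball (min_le_left _ _)).trans hr
    exact ⟨r', _, _, hsub, isStrongOnBall_sub_inv S (by positivity) hsub (min_le_right _ _)⟩
  onto := exists_add_sub_inv_eq S

end Tuples

/-! ### The group graphical Lasso regularizer -/

section Regularizer

variable {p K : ℕ}

/-- A finite, continuous, subadditive and positively homogeneous function is closed, convex and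
positively homogeneous in the extended real valued sense. -/
lemma isClosedConvexPosHom_coe {E : Type*} [NormedAddCommGroup E] [InnerProductSpace ℝ E]
    {ρ : E → ℝ} (hc : Continuous ρ) (hadd : ∀ x y, ρ (x + y) ≤ ρ x + ρ y)
    (hsmul : ∀ (t : ℝ) x, 0 ≤ t → ρ (t • x) = t * ρ x) :
    IsClosedConvexPosHom fun x => (ρ x : EReal) where
  ne_bot _ := EReal.coe_ne_bot _
  exists_ne_top := ⟨0, EReal.coe_ne_top _⟩
  closed := (continuous_coe_real_ereal.comp hc).lowerSemicontinuous
  convex := by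
    rintro ⟨x, s⟩ hx ⟨y, t⟩ hy a b ha hb -
    simp only [Set.mem_ofPred_eq, EReal.coe_le_coe_iff, Prod.smul_mk, Prod.mk_add_mk,
      smul_eq_mul] at *
    calc ρ (a • x + b • y) ≤ a * ρ x + b * ρ y := by
          rw [← hsmul a x ha, ← hsmul b y hb]; exact hadd _ _
      _ ≤ a * s + b * t := by gcongr
  posHom t x ht := by rw [hsmul t x ht.le, EReal.coe_mul]

lemma isClosedConvexPosHom_gglReg {lam₁ lam₂ : ℝ} (h₁ : 0 < lam₁) (h₂ : 0 < lam₂) :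
    IsClosedConvexPosHom (gglReg lam₁ lam₂ : SymTuple p K → EReal) := by
  -- Each group term is the Euclidean norm of the vector of the `(i, j)` entries.
  have hnorm : ∀ (Θ : SymTuple p K) (q : Fin p × Fin p), Real.sqrt (∑ k, |Θ.mat k q.1 q.2| ^ 2) =
      ‖(WithLp.toLp 2 fun k => Θ.1 (k, q.1, q.2) : EuclideanSpace ℝ (Fin K))‖ := fun Θ q => by
    rw [EuclideanSpace.norm_eq]; simp
  unfold gglReg
  refine isClosedConvexPosHom_coe ?_ ?_ ?_
  · simp only [mat_apply]
    fun_prop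
  · intro X Y
    simp only [hnorm]
    rw [add_add_add_comm, ← mul_add, ← mul_add, ← Finset.sum_add_distrib,
      ← Finset.sum_add_distrib]
    simp only [← Finset.sum_add_distrib]
    gcongr with k _ q _ q _
    · exact abs_add_le _ _
    · exact norm_add_le
        (WithLp.toLp 2 fun k => X.1 (k, q.1, q.2) : EuclideanSpace ℝ (Fin K))
        (WithLp.toLp 2 fun k => Y.1 (k, q.1, q.2))
  · intro t X ht
    have e : ∀ q : Fin p × Fin p,
        ‖(WithLp.toLp 2 fun k => (t • X).1 (k, q.1, q.2) : EuclideanSpace ℝ (Fin K))‖ =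
          t * ‖(WithLp.toLp 2 fun k => X.1 (k, q.1, q.2) : EuclideanSpace ℝ (Fin K))‖ := fun q => by
      have h := norm_smul t (WithLp.toLp 2 fun k => X.1 (k, q.1, q.2) : EuclideanSpace ℝ (Fin K))
      rwa [Real.norm_of_nonneg ht] at h
    have e' : ∀ (k : Fin K) (q : Fin p × Fin p),
        |(t • X).mat k q.1 q.2| = t * |X.mat k q.1 q.2| := fun k q => by
      have : (t • X).mat k q.1 q.2 = t * X.mat k q.1 q.2 := rfl
      rw [this, abs_mul, abs_of_nonneg ht]
    simp only [hnorm, e]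
    simp only [e', ← Finset.mul_sum]
    ring

end Regularizer

/-! ### The KKT systems of the joint graphical model -/

section Model

variable {p K : ℕ} {S : SymTuple p K} {P : SymTuple p K → EReal}

/-- The saddle point description of perturbed KKT points splits into one subgradient condition for
each of the two functions and the feasibility of the pair `(Ω, Θ)`. Some point of finite objective
value is needed: without it every triple would satisfy the condition on the subgradients. -/
lemma mem_kktSol_iff (hbot : ∀ Θ, P Θ ≠ ⊥) {Ω₀ Θ₀ : SymTuple p K} (hΩ₀ : loss S Ω₀ ≠ ⊤)
    (hΘ₀ : P Θ₀ ≠ ⊤) (u z : Triple p K) :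
    z ∈ kktSol S P u ↔ IsPerturbedKKT (loss S) P u z := by
  have hb := (isLocallyStronglyConvex_loss S).ne_bot
  obtain ⟨U, V, W⟩ := u
  obtain ⟨Ω, Θ, X⟩ := z
  constructor
  · rintro ⟨h1, h2⟩
    simp only [lagrangian] at h1 h2
    have hfin : loss S Ω ≠ ⊤ ∧ P Θ ≠ ⊤ := by
      have h0 := h1 Ω₀ Θ₀
      have hbΩ := hb Ω₀
      have hbΘ := hbot Θ₀
      lift loss S Ω₀ to ℝ using ⟨hΩ₀, hbΩ⟩ with a
      lift P Θ₀ to ℝ using ⟨hΘ₀, hbΘ⟩ with b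
      constructor
      · intro ht
        rw [ht, EReal.top_add_of_ne_bot (hbot Θ), EReal.top_add_coe, EReal.top_add_coe,
          top_le_iff, ← EReal.coe_add, ← EReal.coe_add] at h0
        exact EReal.coe_ne_top _ h0
      · intro ht
        rw [ht, EReal.add_top_of_ne_bot (hb Ω), EReal.top_add_coe, EReal.top_add_coe,
          top_le_iff, ← EReal.coe_add, ← EReal.coe_add] at h0
        exact EReal.coe_ne_top _ h0
    obtain ⟨a, ha⟩ : ∃ a : ℝ, loss S Ω = a := by
      have h3 := hfin.1
      have h4 := hb Ω
      lift loss S Ω to ℝ using ⟨h3, h4⟩ with a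
      exact ⟨a, rfl⟩
    obtain ⟨b, hb'⟩ : ∃ b : ℝ, P Θ = b := by
      have h3 := hfin.2
      have h4 := hbot Θ
      lift P Θ to ℝ using ⟨h3, h4⟩ with b
      exact ⟨b, rfl⟩
    rw [ha, hb'] at h1 h2
    refine ⟨isSubgradient_of_real ha fun Ω' => ?_, isSubgradient_of_real hb' fun Θ' => ?_, ?_⟩
    · have h3 := h1 Ω' Θ
      rw [hb'] at h3
      induction ha' : loss S Ω' with
      | bot => exact absurd ha' (hb Ω')
      | top => exact le_top
      | coe a' =>
        rw [ha'] at h3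
        simp only [← EReal.coe_add, EReal.coe_le_coe_iff, sub_self, inner_zero_right] at h3 ⊢
        simp only [inner_sub_left, inner_sub_right, real_inner_comm X] at h3 ⊢
        linarith
    · have h3 := h1 Ω Θ'
      rw [ha] at h3
      induction hb'' : P Θ' with
      | bot => exact absurd hb'' (hbot Θ')
      | top => exact le_top
      | coe b' =>
        rw [hb''] at h3
        simp only [← EReal.coe_add, EReal.coe_le_coe_iff, sub_self, inner_zero_right] at h3 ⊢
        simp only [inner_sub_right, inner_add_left, real_inner_comm X] at h3 ⊢
        linarith
    · have h3 := h2 (X + (Ω - Θ + W))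
      simp only [← EReal.coe_add, EReal.coe_le_coe_iff, add_sub_cancel_left] at h3
      have h4 : inner ℝ (Ω - Θ + W) (Ω - Θ + W) ≤ 0 := by
        rw [inner_add_right] at h3
        rw [inner_add_left]
        rw [inner_neg_left] at h3
        linarith
      have h5 : Ω - Θ + W = 0 := 
        inner_self_eq_zero.1 (le_antisymm h4 (real_inner_self_nonneg (x := Ω - Θ + W)))
      have h6 : Θ = Ω + W - (Ω - Θ + W) := by abel
      rw [h5, sub_zero] at h6
      exact h6
  · rintro ⟨h1, h2, h3⟩
    obtain ⟨a, ha, h1⟩ := h1.exists_real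
    obtain ⟨b, hb', h2⟩ := h2.exists_real
    dsimp only at *
    refine ⟨fun Ω' Θ' => ?_, fun X' => ?_⟩
    · simp only [lagrangian]
      rw [ha, hb']
      have h1 := h1 Ω'
      have h2 := h2 Θ'
      induction ha' : loss S Ω' with
      | bot => exact absurd ha' (hb Ω')
      | top => rw [EReal.top_add_of_ne_bot (hbot Θ'), EReal.top_add_coe]; exact le_top
      | coe a' =>
        induction hb'' : P Θ' with
        | bot => exact absurd hb'' (hbot Θ')
        | top => rw [EReal.coe_add_top, EReal.top_add_coe]; exact le_top
        | coe b' =>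
          rw [ha'] at h1
          rw [hb''] at h2
          simp only [← EReal.coe_add, EReal.coe_le_coe_iff] at h1 h2 ⊢
          simp only [inner_sub_left, inner_sub_right, inner_add_left, real_inner_comm X] at h1 h2 ⊢
          linarith
    · simp only [lagrangian]
      rw [ha, hb', h3]
      simp only [← EReal.coe_add, EReal.coe_le_coe_iff]
      rw [show Ω - (Ω + W) = -W by abel, inner_sub_right]
      linarith

lemma isKKT_iff (hP : ResolventOnto P) (z : Triple p K) :
    IsKKT S P z ↔ IsPerturbedKKT (loss S) P 0 z := by
  have hf := (isLocallyStronglyConvex_loss S).resolventOnto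
  obtain ⟨Ω, Θ, X⟩ := z
  have e1 : X + prox (conjugate (loss S)) (Ω - X) = 0 ↔ IsSubgradient (loss S) Ω (-X) := by
    rw [← hf.prox_conjugate_eq_iff, add_eq_zero_iff_neg_eq, ← sub_eq_add_neg, eq_comm]
  have e2 : -X + prox (conjugate P) (Θ + X) = 0 ↔ IsSubgradient P Θ X := by
    rw [← hP.prox_conjugate_eq_iff, neg_add_eq_zero, eq_comm]
  constructor
  · rintro ⟨h1, h2, h3⟩
    exact ⟨by simpa using e1.1 h1, by simpa using e2.1 h2, by
      simpa [eq_comm] using sub_eq_zero.1 h3⟩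
  · rintro ⟨h1, h2, h3⟩
    refine ⟨e1.2 (by simpa using h1), e2.2 (by simpa using h2), ?_⟩
    simpa [sub_eq_zero, eq_comm] using h3

/-- At a solution the loss is differentiable, so no constraint qualification is needed for the first
order optimality condition. -/
lemma isSubgradient_neg_gradient_of_mem_solutionSet (hbot : ∀ Θ, P Θ ≠ ⊥)
    (hconv : Convex ℝ {q : SymTuple p K × ℝ | P q.1 ≤ ((q.2 : ℝ) : EReal)}) {x : SymTuple p K}
    (hx : x ∈ solutionSet S P) :
    x ∈ posDefTuples p K ∧ IsSubgradient P x (-(S - x.inv)) := by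
  have hf := isLocallyStronglyConvex_loss S
  obtain ⟨hfin, hmin⟩ := hx
  have hxt : loss S x ≠ ⊤ := fun h => by
    rw [h, EReal.top_add_of_ne_bot (hbot x)] at hfin
    exact lt_irrefl _ hfin
  have hPt : P x ≠ ⊤ := fun h => by
    rw [h, EReal.add_top_of_ne_bot (hf.ne_bot x)] at hfin
    exact lt_irrefl _ hfin
  have hxD := hf.mem_of_ne_top hxt
  refine ⟨hxD, hPt, hbot x, fun x' => ?_⟩
  refine subgradient_inequality_of_min (φ := realLoss S) (G := fun X => S - X.inv) hbot hconv hPt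
    (hf.continuousAt hxD) ?_ ?_
  · filter_upwards [hf.isOpen.mem_nhds hxD] with y hy
    exact hf.gradient y hy x hxD
  · have hcont : ContinuousAt (fun t : ℝ => x + t • (x' - x)) 0 := by fun_prop
    have hev : ∀ᶠ t in 𝓝 (0 : ℝ), x + t • (x' - x) ∈ posDefTuples p K :=
      hcont.eventually (hf.isOpen.mem_nhds (by simpa using hxD))
    filter_upwards [nhdsWithin_le_nhds hev] with t ht
    rw [← hf.coe_eq x hxD, ← hf.coe_eq _ ht]
    exact hmin _

lemma norm_le_tripleNorm (z : Triple p K) :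
    ‖z.1‖ ≤ tripleNorm z ∧ ‖z.2.1‖ ≤ tripleNorm z ∧ ‖z.2.2‖ ≤ tripleNorm z := by
  have h1 := sq_nonneg ‖z.1‖
  have h2 := sq_nonneg ‖z.2.1‖
  have h3 := sq_nonneg ‖z.2.2‖
  refine ⟨?_, ?_, ?_⟩ <;> exact Real.le_sqrt_of_sq_le (by linarith)

lemma tripleNorm_le (z : Triple p K) : tripleNorm z ≤ ‖z.1‖ + ‖z.2.1‖ + ‖z.2.2‖ := by
  have h1 := norm_nonneg z.1
  have h2 := norm_nonneg z.2.1
  have h3 := norm_nonneg z.2.2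
  refine Real.sqrt_le_iff.2 ⟨by positivity, ?_⟩
  nlinarith [mul_nonneg h1 h2, mul_nonneg h1 h3, mul_nonneg h2 h3]

/-! ### Nonsingularity of the generalized Jacobian -/

/-- The closed cone of pairs (increment of the argument, increment of the residual) cut out by the
firm nonexpansiveness of `Prox_{P*}`, the strict firm nonexpansiveness (with constant `c`) of
`Prox_{f*}`, and the linear third component of the residual map. -/
def residualCone (p K : ℕ) (c : ℝ) : Set ((Triple p K × Triple p K) × Triple p K) :=
  {q | ‖q.2.1 - (q.1.2.2.2 - q.1.1.1)‖ ^ 2 + c * ‖q.1.2.1 - q.1.2.2.2 + q.1.1.1‖ ^ 2 ≤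
        inner ℝ (q.2.1 - (q.1.2.2.2 - q.1.1.1)) (q.1.2.1 - q.1.2.2.2 + q.1.1.1) ∧
      ‖q.2.2.1 + q.1.2.2.2 + q.1.1.2.1‖ ^ 2 ≤
        inner ℝ (q.2.2.1 + q.1.2.2.2 + q.1.1.2.1) (q.1.2.2.1 + q.1.2.2.2 + q.1.1.2.1) ∧
      q.2.2.2 = q.1.2.1 - q.1.2.2.1 + q.1.1.2.2}

lemma isClosed_residualCone (c : ℝ) : IsClosed (residualCone p K c) := by
  refine IsClosed.and (isClosed_le ?_ ?_) (IsClosed.and (isClosed_le ?_ ?_) (isClosed_eq ?_ ?_)) <;>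
    fun_prop

lemma smul_mem_residualCone {c t : ℝ} {q : (Triple p K × Triple p K) × Triple p K}
    (hq : q ∈ residualCone p K c) : t • q ∈ residualCone p K c := by
  obtain ⟨⟨⟨U, V, W⟩, ⟨Ω, Θ, X⟩⟩, ⟨A, B, C⟩⟩ := q
  obtain ⟨h1, h2, h3⟩ := hq
  simp only [residualCone, Set.mem_ofPred_eq, Prod.smul_mk] at *
  simp only [← smul_sub, ← smul_add, norm_smul, mul_pow, inner_smul_left, inner_smul_right,
    Real.norm_eq_abs, sq_abs, RCLike.conj_to_real]
  refine ⟨?_, ?_, by rw [h3]⟩ <;> nlinarith [sq_nonneg t]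

/-- For fixed `v`, the (strict) firm nonexpansiveness inequality describes a convex set of vectors
`a`: a sublevel set of a convex quadratic function. -/
lemma convex_firm {E : Type*} [NormedAddCommGroup E] [InnerProductSpace ℝ E] (w v : E) (b : ℝ) :
    Convex ℝ {a : E | ‖a - w‖ ^ 2 + b ≤ inner ℝ (a - w) v} := by
  intro x hx y hy s t hs ht hst
  simp only [Set.mem_ofPred_eq] at *
  have e : s • x + t • y - w = s • (x - w) + t • (y - w) := by
    calc s • x + t • y - w = s • x + t • y - (s + t) • w := by rw [hst, one_smul]
      _ = _ := by rw [smul_sub, smul_sub, add_smul]; abel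
  have hsq : ‖s • (x - w) + t • (y - w)‖ ^ 2 ≤ s * ‖x - w‖ ^ 2 + t * ‖y - w‖ ^ 2 := by
    have hc : ConvexOn ℝ Set.univ fun z : E => ‖z‖ ^ 2 :=
      (convexOn_norm convex_univ).pow (fun _ _ => norm_nonneg _) 2
    simpa using hc.2 (Set.mem_univ (x - w)) (Set.mem_univ (y - w)) hs ht hst
  rw [e, inner_add_left, inner_smul_left, inner_smul_left]
  simp only [RCLike.conj_to_real]
  have h1 := mul_le_mul_of_nonneg_left hx hs
  have h2 := mul_le_mul_of_nonneg_left hy ht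
  have h3 : b = s * b + t * b := by rw [← add_mul, hst, one_mul]
  linarith

lemma convex_residualCone_fibre (c : ℝ) (h : Triple p K × Triple p K) :
    Convex ℝ {k | (h, k) ∈ residualCone p K c} := by
  obtain ⟨⟨U, V, W⟩, ⟨Ω, Θ, X⟩⟩ := h
  have h1 := convex_firm (X - U) (Ω - X + U) (c * ‖Ω - X + U‖ ^ 2)
  have h2 := convex_firm (-X - V) (Θ + X + V) 0
  rintro ⟨A, B, C⟩ ⟨a1, a2, a3⟩ ⟨A', B', C'⟩ ⟨b1, b2, b3⟩ s t hs ht hst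
  dsimp only at *
  have e : ∀ B : SymTuple p K, B - (-X - V) = B + X + V := fun B => by abel
  refine ⟨h1 a1 b1 hs ht hst, ?_, ?_⟩
  · have := h2 (x := B) (y := B') (by simpa [e] using a2) (by simpa [e] using b2) hs ht hst
    simpa [e] using this
  · subst a3 b3
    change s • (Ω - Θ + W) + t • (Ω - Θ + W) = Ω - Θ + W
    rw [← add_smul, hst, one_smul]

/-- The increments of the residual map near the unperturbed solution lie in `residualCone`. -/
lemma kktResidual_increment_mem (hP : ResolventOnto P) {x : SymTuple p K}
    (hx : x ∈ posDefTuples p K) :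
    ∃ c > 0, ∃ N ∈ 𝓝 ((0, (x, x, -(S - x.inv))) : Triple p K × Triple p K),
      ∀ y ∈ N, ∀ y' ∈ N, (y' - y, kktResidual S P y' - kktResidual S P y) ∈ residualCone p K c := by
  obtain ⟨ε, hε, c, hc, h⟩ := (isLocallyStronglyConvex_loss S).prox_conjugate_strict hx
  have hcont : Continuous fun y : Triple p K × Triple p K => y.2.1 - y.2.2.2 + y.1.1 := by
    fun_prop
  have hmem : ((0, (x, x, -(S - x.inv))) : Triple p K × Triple p K) ∈
      (fun y : Triple p K × Triple p K => y.2.1 - y.2.2.2 + y.1.1) ⁻¹'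
        Metric.ball (x + (S - x.inv)) ε := by
    rw [Set.mem_preimage, Prod.fst_zero, add_zero, sub_neg_eq_add]
    exact Metric.mem_ball_self hε
  refine ⟨c, hc, _, (Metric.isOpen_ball.preimage hcont).mem_nhds hmem, ?_⟩
  rintro ⟨⟨U, V, W⟩, ⟨Ω, Θ, X⟩⟩ hy ⟨⟨U', V', W'⟩, ⟨Ω', Θ', X'⟩⟩ hy'
  have k1 := h _ hy' _ hy
  have k2 := hP.firmlyNonexpansive (Θ' + X' + V') (Θ + X + V)
  dsimp only at k1
  have e1 : ∀ a b : SymTuple p K,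
      X' - U' + a - (X - U + b) - (X' - X - (U' - U)) = a - b := fun a b => by abel
  have e2 : ∀ a b : SymTuple p K,
      -X' - V' + a - (-X - V + b) + (X' - X) + (V' - V) = a - b := fun a b => by abel
  have e3 : Ω' - Ω - (X' - X) + (U' - U) = Ω' - X' + U' - (Ω - X + U) := by abel
  have e4 : Θ' - Θ + (X' - X) + (V' - V) = Θ' + X' + V' - (Θ + X + V) := by abel
  simp only [residualCone, kktResidual, Set.mem_ofPred_eq, Prod.mk_sub_mk, e1, e2, e3, e4]
  exact ⟨k1, k2, by abel⟩

/-- An operator whose graph satisfies the constraints of `residualCone` is injective: if `B` maps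
`(Ω, Θ, X)` to zero, then `Ω = Θ`, `⟪X, Ω⟫ ≥ 0` and `-⟪X, Ω⟫ ≥ c ‖Ω - X‖²`, so all of them vanish. -/
lemma bijective_of_mem_residualCone {c : ℝ} (hc : 0 < c)
    (B : Triple p K →L[ℝ] Triple p K) (hB : ∀ z, ((0, z), B z) ∈ residualCone p K c) :
    Function.Bijective B := by
  have hinj : Function.Injective (B : Triple p K →ₗ[ℝ] Triple p K) := by
    rw [← LinearMap.ker_eq_bot, LinearMap.ker_eq_bot']
    rintro ⟨Ω, Θ, X⟩ hz
    have hz' : B (Ω, Θ, X) = 0 := hz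
    obtain ⟨h1, h2, h3⟩ := hB (Ω, Θ, X)
    rw [hz'] at h1 h2 h3
    simp only [Prod.fst_zero, Prod.snd_zero, sub_zero, zero_sub, add_zero, zero_add, norm_neg,
      inner_neg_left] at h1 h2 h3
    have hΩ : Ω = Θ := sub_eq_zero.1 h3.symm
    subst hΩ
    rw [inner_sub_right, real_inner_self_eq_norm_sq] at h1
    rw [inner_add_right, real_inner_self_eq_norm_sq] at h2
    have h4 := mul_nonneg hc.le (sq_nonneg ‖Ω - X‖)
    have h5 : c * ‖Ω - X‖ ^ 2 = 0 := le_antisymm (by linarith) h4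
    have h6 : Ω = X := by
      have : ‖Ω - X‖ ^ 2 = 0 := (mul_eq_zero.1 h5).resolve_left hc.ne'
      exact sub_eq_zero.1 (norm_eq_zero.1 ((pow_eq_zero_iff two_ne_zero).1 this))
    subst h6
    rw [real_inner_self_eq_norm_sq] at h1 h2
    have h7 : ‖Ω‖ ^ 2 = 0 := le_antisymm (by linarith) (sq_nonneg _)
    have h8 : Ω = 0 := norm_eq_zero.1 ((pow_eq_zero_iff two_ne_zero).1 h7)
    rw [h8]
    rfl
  exact ⟨hinj, LinearMap.injective_iff_surjective.1 hinj⟩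

end Model

end GGL

theorem theorem3p1 (p K : ℕ) (n : Fin K → ℕ) (hn : ∀ k, 0 < n k)
    (w : (k : Fin K) → Matrix (Fin (n k)) (Fin p) ℝ)
    (P : SymTuple p K → EReal)
    -- `P` is the group graphical Lasso regularizer or any convex positively homogeneous function
    (hP : (∃ lam₁ lam₂ : ℝ, 0 < lam₁ ∧ 0 < lam₂ ∧ P = gglReg lam₁ lam₂) ∨ IsClosedConvexPosHom P)
    (hsol : (solutionSet (empCov n w) P).Nonempty) :
    -- the KKT system has a unique solution `zbar`
    ∃ zbar : Triple p K, (∀ z, IsKKT (empCov n w) P z ↔ z = zbar) ∧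
      -- (a)
      (∀ B ∈ partialClarkeJacobian (kktResidual (empCov n w) P) 0 zbar, Function.Bijective B) ∧
      -- (b)
      (∃ N ∈ nhds (0 : Triple p K), ∃ κ : ℝ, 0 < κ ∧
        (∀ u ∈ N, (kktSol (empCov n w) P u).Nonempty) ∧
        (∀ u ∈ N, ∀ u' ∈ N, ∀ z ∈ kktSol (empCov n w) P u, ∀ z' ∈ kktSol (empCov n w) P u',
          tripleNorm (z - z') ≤ κ * tripleNorm (u - u'))) := by
  have hcl : IsClosedConvexPosHom P := by
    rcases hP with ⟨l₁, l₂, h₁, h₂, rfl⟩ | h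
    · exact isClosedConvexPosHom_gglReg h₁ h₂
    · exact h
  generalize empCov n w = S at *
  obtain ⟨x, hx⟩ := hsol
  obtain ⟨hxD, hxP⟩ := isSubgradient_neg_gradient_of_mem_solutionSet hcl.ne_bot hcl.convex hx
  have hf := isLocallyStronglyConvex_loss S
  have hxf := hf.isSubgradient hxD
  have hres := hcl.resolventOnto
  obtain ⟨N, hN, κ, hκ, hex, hlip⟩ :=
    hf.exists_lipschitz_perturbedKKT hcl.ne_bot hcl.closed hcl.convex hxD hxP
  have h0 : IsPerturbedKKT (loss S) P 0 (x, x, -(S - x.inv)) :=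
    ⟨by simpa using hxf, by simpa using hxP, by simp⟩
  have hmem := mem_kktSol_iff (S := S) hcl.ne_bot hxf.1 hxP.1
  refine ⟨(x, x, -(S - x.inv)), fun z => ?_, ?_, N, hN, 3 * κ, by positivity, ?_, ?_⟩
  · rw [isKKT_iff hres]
    refine ⟨fun hz => ?_, fun hz => hz ▸ h0⟩
    obtain ⟨h1, h2, h3⟩ := hlip 0 (mem_of_mem_nhds hN) 0 (mem_of_mem_nhds hN) _ _ hz h0 0
      (by simp) (by simp) (by simp)
    rw [mul_zero] at h1 h2 h3
    exact Prod.ext (sub_eq_zero.1 (norm_le_zero_iff.1 h1))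
      (Prod.ext (sub_eq_zero.1 (norm_le_zero_iff.1 h2)) (sub_eq_zero.1 (norm_le_zero_iff.1 h3)))
  · rintro B ⟨M, hM⟩
    obtain ⟨c, hc, hinc⟩ := kktResidual_increment_mem (S := S) hres hxD
    refine bijective_of_mem_residualCone hc B fun z => ?_
    have := clarkeJacobian_graph_subset (isClosed_residualCone c)
      (fun t _ q hq => smul_mem_residualCone hq) (convex_residualCone_fibre c) hinc hM (0, z)
    simpa using this
  · intro u hu
    obtain ⟨z, hz⟩ := hex u hu
    exact ⟨z, (hmem u z).2 hz⟩
  · intro u hu u' hu' z hz z' hz'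
    obtain ⟨d1, d2, d3⟩ := norm_le_tripleNorm (u - u')
    obtain ⟨b1, b2, b3⟩ :=
      hlip u hu u' hu' z z' ((hmem u z).1 hz) ((hmem u' z').1 hz') _ d1 d2 d3
    have := tripleNorm_le (z - z')
    simp only [Prod.fst_sub, Prod.snd_sub] at this
    linarith
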